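/- \textbf{Setting.} Fix $K\ge 1$ arms with base rewards $b_k\in\mathbb R$, retention factors $\gamma_k\in[0,1)$ and exposure factors $\lambda_k\ge 0$ ($k\in[K]$), and a noise level $\sigma_z>0$. For parameters $(\gamma_k,\lambda_k,b_k)_{k}$ and a horizon $T\ge1$, let $\mathcal M$ be the following continuous-state MDP. States are $x=(x_1,n_1,\dots,x_K,n_K)$ with $x_k\in\mathbb R$, $n_k\in\mathbb N$; the initial state is $x_{\rm init}=(0,\dots,0)$; actions are the arms. The expected reward of arm $k$ is $r(x,k)=b_k$ if $n_k=0$ and $r(x,k)=b_k-\gamma_k^{n_k}x_k-\lambda_k\gamma_k^{n_k}$ if $n_k\ge1$. After pulling arm $k$, the new value of $n_k$ is $1$; the new value of $x_k$ is $0$ if $n_k=0$, and is drawn from $\mathcal N\big(\gamma_k^{n_k}(x_k+\lambda_k),\ \lambda_k^2\sigma_z^2\sum_{i=0}^{n_k-1}\gamma_k^{2i}\big)$ if $n_k\ge1$; for $k'\ne k$, $x_{k'}$ is unchanged, and $n_{k'}$ increases by $1$ if $n_{k'}\neq0$ and stays $0$ otherwise. A policy $\pi=(\pi_1,\dots,\pi_T)$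 consists of measurable maps from states to arms. Its value function is given by $V^\pi_{T+1,\mathcal M}=0$ and $V^\pi_{t,\mathcal M}(x)=r(x,\pi_t(x))+\mathbb E[V^\pi_{t+1,\mathcal M}(x')]$, where $x'$ is the state that follows $x$ when arm $\pi_t(x)$ is pulled. A policy is optimal for $\mathcal M$ if it maximizes $V_{1,\mathcal M}^{\pi}(x_{\rm init})$. \textbf{Data and estimates.} Fix integers $m\ge1$ and $T_{\min}>1$, and put $a_k=\gamma_k^m$, $d_k=\lambda_k\gamma_k^m$. For each arm $k$ we are given $n$ random trajectories with $\tilde x^{(i)}_{k,1}=0$ and $\tilde x^{(i)}_{k,j+1}=a_k\tilde x^{(i)}_{k,j}+d_k+\tilde z^{(i)}_{k,j}$ for $1\le i\le n$, $1\le j\le T_{\min}$, where for each $k$ the $\tilde z^{(i)}_{k,j}$ are independent $\mathcal N\big(0,\lambda_k^2\sigma_z^2(1-\gamma_k^{2m})/(1-\gamma_k^2)\big)$ variables. With $\tilde y^{(i)}_{k,j}=\tilde x^{(i)}_{k,j}-\tilde x^{(2i)}_{k,j}$ for $1\le i\le\lfloor n/2\rfloor$, let $$\widehat d_k=\frac1n\sum_{i=1}^n\tilde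 x^{(i)}_{k,2},\qquad \widehat a_k=\frac{\sum_{i\le\lfloor n/2\rfloor}\tilde y^{(i)}_{k,T_{\min}}\tilde y^{(i)}_{k,T_{\min}+1}}{\sum_{i\le\lfloor n/2\rfloor}(\tilde y^{(i)}_{k,T_{\min}})^2},\qquad \widehat\gamma_k=|\widehat a_k|^{1/m},\qquad \widehat\lambda_k=|\widehat d_k/\widehat a_k| .$$ (If the denominator of $\widehat a_k$ vanishes, put $\widehat a_k=0$.) Let $\widehat{\mathcal M}$ be the MDP with the parameters $(\widehat\gamma_k,\widehat\lambda_k,b_k)_k$ and the same $\sigma_z$ and $T$. \textbf{Proposition.} Fix $\delta\in(0,1)$ and $0<\underline a<\overline a<1$. There is a constant $C>0$, depending only on $\delta$, $\underline a$, $\overline a$, $K$, $(\gamma_k,\lambda_k,b_k)_k$, $\sigma_z$, $m$ and $T_{\min}$ (not on $T$ or $n$), such that for all $T\ge1$, all $n\ge 64\log(2/\delta)$ and all data as above, there is an event of probability at least $1-\delta$ on which the following holds: if $\widehat a_k\in(\underline a,\overline a)$ for all $k\in[K]$, then optimal policies for $\mathcal M$ and for $\widehat{\mathcal M}$ exist,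 and for every optimal policy $\pi^*_{\mathcal M}$ of $\mathcal M$ and every optimal policy $\pi^*_{\widehat{\mathcal M}}$ of $\widehat{\mathcal M}$, $$\Big|V_{1,\mathcal M}^{\pi^*_{\mathcal M}}(x_{\rm init})-V_{1,\mathcal M}^{\pi^*_{\widehat{\mathcal M}}}(x_{\rm init})\Big|\le C\,\frac{T^2}{\sqrt n}.$$ -/

import Mathlib

open MeasureTheory ProbabilityTheory

noncomputable section

namespace ReboundingBandit

/-- Arm parameters: satiation retention `γ`, exposure influence `lam`, base reward `b`. -/
structure Params (K : ℕ) where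
  γ : Fin K → ℝ
  lam : Fin K → ℝ
  b : Fin K → ℝ

/-- A state lists, for each arm `k`, the pair `(x k).1` = satiation influence as of the most recent
pull and `(x k).2` = number of steps since arm `k` was last pulled (`0` if never pulled). -/
abbrev State (K : ℕ) : Type := Fin K → ℝ × ℕ

/-- The initial state `(0, …, 0)`. -/
def initState (K : ℕ) : State K := fun _ => (0, 0)

/-- The next state after pulling arm `k` in state `x` and observing satiation influence `y`. -/
def nextState {K : ℕ} (x : State K) (k : Fin K) (y : ℝ) : State K := fun j =>
  if j = k then (y, 1) else ((x j).1, if (x j).2 = 0 then 0 else (x j).2 + 1)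

/-- The expected reward of pulling arm `k` in state `x`. -/
def reward {K : ℕ} (M : Params K) (x : State K) (k : Fin K) : ℝ :=
  if (x k).2 = 0 then M.b k
  else M.b k - M.γ k ^ (x k).2 * (x k).1 - M.lam k * M.γ k ^ (x k).2

/-- The law of the satiation influence observed when arm `k` is pulled in state `x`
(the noise in the satiation dynamics has variance `σ ^ 2`). -/
def influenceLaw {K : ℕ} (σ : ℝ) (M : Params K) (x : State K) (k : Fin K) : Measure ℝ :=
  if (x k).2 = 0 then Measure.dirac 0
  else gaussianReal (M.γ k ^ (x k).2 * ((x k).1 + M.lam k))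
    (M.lam k ^ 2 * σ ^ 2 * ∑ i ∈ Finset.range (x k).2, M.γ k ^ (2 * i)).toNNReal

/-- The transition law of the Markov decision process. -/
def transition {K : ℕ} (σ : ℝ) (M : Params K) (x : State K) (k : Fin K) : Measure (State K) :=
  (influenceLaw σ M x k).map (nextState x k)

/-- A (deterministic, state-dependent) policy: the arm pulled at each time in each state. -/
abbrev Policy (K : ℕ) : Type := ℕ → State K → Fin K

/-- `valueAux σ M π r t x`: expected total reward of `π` over the `r` steps `t, …, t + r - 1`,
starting from state `x` at time `t`. -/
def valueAux {K : ℕ} (σ : ℝ) (M : Params K) (π : Policy K) : ℕ → ℕ → State K → ℝ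
  | 0, _, _ => 0
  | r + 1, t, x =>
      reward M x (π t x) + ∫ x', valueAux σ M π r (t + 1) x' ∂(transition σ M x (π t x))

/-- The value function `V_{t,M}^π` with horizon `T`; it vanishes at time `T + 1`. -/
def value {K : ℕ} (σ : ℝ) (M : Params K) (T : ℕ) (π : Policy K) (t : ℕ) (x : State K) : ℝ :=
  valueAux σ M π (T + 1 - t) t x

/-- `π` is an optimal state-dependent policy for horizon `T`: it is measurable and maximizes
`V_{1,M}^π(x_init)` among all measurable policies. -/
def IsOptimal {K : ℕ} (σ : ℝ) (M : Params K) (T : ℕ) (π : Policy K) : Prop :=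
  (∀ t, Measurable (π t)) ∧
    ∀ π' : Policy K, (∀ t, Measurable (π' t)) →
      value σ M T π' 1 (initState K) ≤ value σ M T π 1 (initState K)

/-- The random array `x` is a dataset for one arm with parameters `γ`, `lam`: `x i j` is the `j`-th
observed satiation influence (`1 ≤ j ≤ Tmin + 1`) of the `i`-th trajectory (`1 ≤ i ≤ n`), where the
arm is pulled every `m` steps. -/
def IsDataset {Ω : Type*} [MeasurableSpace Ω] (P : Measure Ω) (σ γ lam : ℝ) (m n Tmin : ℕ)
    (x : ℕ → ℕ → Ω → ℝ) : Prop :=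
  ∃ z : ℕ → ℕ → Ω → ℝ,
    (∀ i ∈ Finset.Icc 1 n, ∀ j ∈ Finset.Icc 1 Tmin,
      HasLaw (z i j)
        (gaussianReal 0 (lam ^ 2 * σ ^ 2 * (1 - γ ^ (2 * m)) / (1 - γ ^ 2)).toNNReal) P) ∧
    iIndepFun (fun (p : ↥(Finset.Icc 1 n ×ˢ Finset.Icc 1 Tmin)) => z p.1.1 p.1.2) P ∧
    (∀ i ∈ Finset.Icc 1 n, ∀ ω, x i 1 ω = 0) ∧
    (∀ i ∈ Finset.Icc 1 n, ∀ j ∈ Finset.Icc 1 Tmin, ∀ ω,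
      x i (j + 1) ω = γ ^ m * x i j ω + lam * γ ^ m + z i j ω)

/-- The estimate of `lam * γ ^ m`: the average of the second entries of the `n` trajectories. -/
def dHat (n : ℕ) (x : ℕ → ℕ → ℝ) : ℝ := (∑ i ∈ Finset.Icc 1 n, x i 2) / n

/-- The ordinary least squares estimate of `γ ^ m` from the differences
`y i j = x i j - x (2 * i) j`, `1 ≤ i ≤ n / 2`. -/
def aHat (n Tmin : ℕ) (x : ℕ → ℕ → ℝ) : ℝ :=
  (∑ i ∈ Finset.Icc 1 (n / 2),
      (x i Tmin - x (2 * i) Tmin) * (x i (Tmin + 1) - x (2 * i) (Tmin + 1))) /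
    ∑ i ∈ Finset.Icc 1 (n / 2), (x i Tmin - x (2 * i) Tmin) ^ 2

/-- The estimated parameters; the base rewards are known exactly. -/
def estimate {K : ℕ} (M : Params K) (m n Tmin : ℕ) (x : Fin K → ℕ → ℕ → ℝ) : Params K where
  γ k := |aHat n Tmin (x k)| ^ (1 / (m : ℝ))
  lam k := |dHat n (x k) / aHat n Tmin (x k)|
  b := M.b

end ReboundingBandit

end

/-!
The gap between the values of the two optimal policies is at most twice the largest change of the
value of a single policy when the true parameters `M` are replaced by the estimates `M'`: `π*`
earns about as much in `M'` as in `M`, the policy `π'` optimal for `M'` earns at least as much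
there, and `π'` earns about as much in `M` as in `M'` (`exists_abs_value_sub_value_le`).

For a single policy the change is bounded step by step (`exists_abs_valueAux_sub_le`). A policy is
only measurable in the state, so value functions have no regularity. The Gaussian transitions
supply it: the expectation of a measurable function of linear growth is Lipschitz in the mean and
the standard deviation (`exists_abs_integral_gaussian_sub_le`), because the densities are close,
with a Gaussian bound on their difference. Values and errors are unbounded in the state. With `r`
steps to go, values are of the order of the potential `U r x = (c + 1) r + ∑ k, |x k|` and errors
of the order of its square. A pull of arm `k` lowers the expectations of `U` and of `U ^ 2` by
multiples of `1 + |x k|` and of `(1 + |x k|) U` (`integral_potential_nextState_le`), which is what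
one step contributes. Since `∑ k, |x k|` vanishes initially, the total is of order `T ^ 2` times
the parameter error. The same growth bounds provide the integrability that makes backward
induction work (`exists_isOptimal`).

The parameter error is of order `1 / √n` with probability `1 - δ` (`exists_estimation_error_le`).
As the constant may depend on `δ`, second moments suffice. The differences `y i` share
trajectories and are not independent. In the numerator of `aHat - γ ^ m` the summands are
nevertheless orthogonal, as each contains a fresh noise variable. In the denominator it is enough
to keep the indices `n / 4 < i ≤ n / 2`, for which the pairs `{i, 2 i}` are disjoint, and to
truncate the squares at `1`. For small `n` the bound on `aHat` is trivial, as both `aHat` and `γ ^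
m` lie in `[0, 1]`. An arm with `lam = 0` gives constant data, hence `aHat = 0` almost surely, so
that no estimate lies in the prescribed interval. The lower bound on `aHat` turns errors of `aHat`
and `dHat` into errors of the parameters (`estimate_error_le`).
-/

noncomputable section

namespace ReboundingBandit

/-! ### Gaussian expectations as functions of the parameters -/

lemma abs_exp_sub_one_le_mul_exp_abs (L : ℝ) : |Real.exp L - 1| ≤ |L| * Real.exp |L| := by
  rcases le_total 0 L with h | h
  · rw [abs_of_nonneg h, abs_of_nonneg (by linarith [Real.add_one_le_exp L])]
    have h1 : 1 - L ≤ Real.exp (-L) := by linarith [Real.add_one_le_exp (-L)]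
    have h2 : Real.exp L * Real.exp (-L) = 1 := by rw [← Real.exp_add]; simp
    nlinarith [Real.exp_pos L]
  · rw [abs_of_nonpos h, abs_of_nonpos (by linarith [Real.exp_le_one_iff.2 h])]
    have h1 := Real.add_one_le_exp L
    have h2 : 1 ≤ Real.exp (-L) := Real.one_le_exp (by linarith)
    nlinarith

lemma gaussianPDFReal_sq_eq {t : ℝ} (ht : 0 < t) (δ g : ℝ) :
    gaussianPDFReal δ (t ^ 2).toNNReal g =
      (√(2 * Real.pi))⁻¹ * Real.exp (-Real.log t - (g - δ) ^ 2 / (2 * t ^ 2)) := by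
  have h1 : √(2 * Real.pi * t ^ 2) = √(2 * Real.pi) * t := by
    rw [Real.sqrt_mul (by positivity), Real.sqrt_sq ht.le]
  rw [gaussianPDFReal, Real.coe_toNNReal _ (by positivity), h1, sub_eq_add_neg (-Real.log t),
    Real.exp_add, Real.exp_neg (Real.log t), Real.exp_log ht, mul_inv, neg_div, mul_assoc]

/-- Log-likelihood ratio of `N(δ, t²)` against `N(0, 1)`: near the standard parameters it is at most
a quadratic in `g`, times the distance of the parameters. -/
lemma abs_log_likelihood_ratio_le {δ t : ℝ} (h : |δ| + |t - 1| ≤ 1 / 32) (g : ℝ) :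
    |-Real.log t - (g - δ) ^ 2 / (2 * t ^ 2) + g ^ 2 / 2| ≤
      4 * (|δ| + |t - 1|) * (1 + |g|) ^ 2 := by
  set u := |δ| + |t - 1| with hu
  have hδ : |δ| ≤ u := by rw [hu]; linarith [abs_nonneg (t - 1)]
  have htu : |t - 1| ≤ u := by rw [hu]; linarith [abs_nonneg δ]
  have hu0 : 0 ≤ u := (abs_nonneg _).trans hδ
  have hδ' := abs_le.1 hδ
  have ht' := abs_le.1 htu
  have ht : 31 / 32 ≤ t := by linarith
  have ht0 : 0 < t := by linarith
  have hlog : |Real.log t| ≤ 2 * u := by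
    rw [abs_le]
    constructor
    · have h1 := Real.one_sub_inv_le_log_of_pos ht0
      have h2 : t⁻¹ ≤ 1 + 2 * u := by
        rw [inv_le_iff_one_le_mul₀ ht0]
        nlinarith
      linarith
    · linarith [Real.log_le_sub_one_of_pos ht0]
  have hG : 1 ≤ 1 + |g| := by linarith [abs_nonneg g]
  have hq : |-((g - δ) ^ 2 / (2 * t ^ 2)) + g ^ 2 / 2| ≤ 2 * u * (1 + |g|) ^ 2 := by
    have e : -((g - δ) ^ 2 / (2 * t ^ 2)) + g ^ 2 / 2 =
        ((g * (t - 1) + δ) * (g * (t + 1) - δ)) / (2 * t ^ 2) := by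
      field_simp
      ring
    rw [e, abs_div, abs_mul, abs_of_pos (by positivity : 0 < 2 * t ^ 2),
      div_le_iff₀ (by positivity)]
    have h1 : |g * (t - 1) + δ| ≤ u * (1 + |g|) := by
      calc _ ≤ |g * (t - 1)| + |δ| := abs_add_le _ _
        _ = |g| * |t - 1| + |δ| := by rw [abs_mul]
        _ ≤ _ := by nlinarith [abs_nonneg g]
    have h2 : |g * (t + 1) - δ| ≤ 3 * (1 + |g|) := by
      calc _ ≤ |g * (t + 1)| + |δ| := abs_sub _ _
        _ = |g| * (t + 1) + |δ| := by rw [abs_mul, abs_of_pos (by linarith : 0 < t + 1)]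
        _ ≤ _ := by nlinarith [abs_nonneg g]
    have h3 : 3 ≤ 2 * (2 * t ^ 2) := by nlinarith
    calc _ ≤ (u * (1 + |g|)) * (3 * (1 + |g|)) := by gcongr
      _ = 3 * (u * (1 + |g|) ^ 2) := by ring
      _ ≤ (2 * (2 * t ^ 2)) * (u * (1 + |g|) ^ 2) := by gcongr
      _ = _ := by ring
  have e2 : -Real.log t - (g - δ) ^ 2 / (2 * t ^ 2) + g ^ 2 / 2 =
      -Real.log t + (-((g - δ) ^ 2 / (2 * t ^ 2)) + g ^ 2 / 2) := by ring
  rw [e2]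
  refine (abs_add_le _ _).trans ?_
  rw [abs_neg]
  have hG2 : u ≤ u * (1 + |g|) ^ 2 := le_mul_of_one_le_right hu0 (one_le_pow₀ hG)
  linarith

/-- The densities of `N(δ, t²)` and `N(0, 1)` differ by at most a multiple of the distance of the
parameters, with a Gaussian tail. -/
lemma abs_gaussianPDFReal_sub_le {δ t : ℝ} (h : |δ| + |t - 1| ≤ 1 / 32) (g : ℝ) :
    |gaussianPDFReal δ (t ^ 2).toNNReal g - gaussianPDFReal 0 1 g| ≤
      8 * (|δ| + |t - 1|) * ((1 + |g|) ^ 2 * Real.exp (-(1 / 4) * g ^ 2)) := by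
  have ht0 : 0 < t := by
    have := abs_nonneg δ
    have := (abs_le.1 (by linarith : |t - 1| ≤ 1 / 32)).1
    linarith
  set u := |δ| + |t - 1| with hu
  have hu0 : 0 ≤ u := by positivity
  set L := -Real.log t - (g - δ) ^ 2 / (2 * t ^ 2) + g ^ 2 / 2 with hL
  have hLb : |L| ≤ 4 * u * (1 + |g|) ^ 2 := abs_log_likelihood_ratio_le h g
  have e1 : gaussianPDFReal 0 1 g = (√(2 * Real.pi))⁻¹ * Real.exp (-(g ^ 2 / 2)) := by
    simp [gaussianPDFReal, neg_div]
  have e2 : gaussianPDFReal δ (t ^ 2).toNNReal g - gaussianPDFReal 0 1 g =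
      (√(2 * Real.pi))⁻¹ * (Real.exp (-(g ^ 2 / 2)) * (Real.exp L - 1)) := by
    rw [gaussianPDFReal_sq_eq ht0, e1, mul_sub (Real.exp _), ← Real.exp_add, hL]
    ring_nf
  have hc : (√(2 * Real.pi))⁻¹ ≤ 1 := by
    apply inv_le_one_of_one_le₀
    rw [Real.one_le_sqrt]
    linarith [Real.pi_gt_three]
  have hL2 : |L| ≤ g ^ 2 / 4 + 1 / 4 := by
    have : (1 + |g|) ^ 2 ≤ 2 * g ^ 2 + 2 := by
      nlinarith [sq_nonneg (1 - |g|), sq_abs g]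
    calc |L| ≤ 4 * u * (1 + |g|) ^ 2 := hLb
      _ ≤ 4 * (1 / 32) * (2 * g ^ 2 + 2) := by gcongr
      _ = _ := by ring
  have hexp : Real.exp (1 / 4) ≤ 2 := by
    have := Real.exp_one_lt_d9
    have h1 : Real.exp (1 / 4) ^ 4 = Real.exp 1 := by rw [← Real.exp_nat_mul]; norm_num
    by_contra hcon
    push Not at hcon
    have : (2 : ℝ) ^ 4 ≤ Real.exp (1 / 4) ^ 4 := by gcongr
    linarith
  rw [e2, abs_mul, abs_mul, abs_of_pos (Real.exp_pos _), abs_of_nonneg (by positivity)]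
  calc (√(2 * Real.pi))⁻¹ * (Real.exp (-(g ^ 2 / 2)) * |Real.exp L - 1|)
      ≤ 1 * (Real.exp (-(g ^ 2 / 2)) * (|L| * Real.exp |L|)) := by
        gcongr
        exact abs_exp_sub_one_le_mul_exp_abs L
    _ ≤ 1 * (Real.exp (-(g ^ 2 / 2)) *
          (4 * u * (1 + |g|) ^ 2 * Real.exp (g ^ 2 / 4 + 1 / 4))) := by gcongr
    _ = 4 * u * (1 + |g|) ^ 2 * (Real.exp (1 / 4) * Real.exp (-(1 / 4) * g ^ 2)) := by
        rw [← Real.exp_add, one_mul, mul_left_comm, ← Real.exp_add]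
        congr 2
        ring
    _ ≤ 4 * u * (1 + |g|) ^ 2 * (2 * Real.exp (-(1 / 4) * g ^ 2)) := by gcongr
    _ = _ := by ring

lemma integrable_one_add_abs_pow_mul_exp :
    Integrable (fun g : ℝ => (1 + |g|) ^ 3 * Real.exp (-(1 / 4) * g ^ 2)) := by
  have h0 : Integrable (fun g : ℝ => Real.exp 18 * Real.exp (-(1 / 8) * g ^ 2)) :=
    (integrable_exp_neg_mul_sq (by norm_num)).const_mul _
  refine h0.mono' (by fun_prop) (ae_of_all _ fun g => ?_)
  rw [Real.norm_of_nonneg (by positivity)]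
  -- `(1 + |g|) ^ 3 ≤ exp (3 |g|)` and `3 |g| ≤ g ^ 2 / 8 + 18`
  have h1 : (1 + |g|) ^ 3 ≤ Real.exp (3 * |g|) := by
    have : 1 + |g| ≤ Real.exp |g| := by linarith [Real.add_one_le_exp |g|]
    calc (1 + |g|) ^ 3 ≤ (Real.exp |g|) ^ 3 := by gcongr
      _ = _ := by rw [← Real.exp_nat_mul]; norm_num
  calc (1 + |g|) ^ 3 * Real.exp (-(1 / 4) * g ^ 2)
      ≤ Real.exp (3 * |g|) * Real.exp (-(1 / 4) * g ^ 2) := by gcongr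
    _ ≤ _ := by
      rw [← Real.exp_add, ← Real.exp_add]
      apply Real.exp_le_exp.2
      nlinarith [sq_nonneg (|g| - 12), sq_abs g]

/-- The standard normal distribution. -/
abbrev stdGaussian : Measure ℝ := gaussianReal 0 1

lemma stdGaussian_map_affine (a t : ℝ) :
    stdGaussian.map (fun g => a + t * g) = gaussianReal a (t ^ 2).toNNReal := by
  have h1 : stdGaussian.map (fun g => t * g) = gaussianReal 0 (t ^ 2).toNNReal := by
    rw [gaussianReal_map_const_mul]
    congr 1
    · simp
    · ext; simp [Real.coe_toNNReal _ (sq_nonneg t)]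
  have h2 := gaussianReal_map_const_add (μ := 0) (v := (t ^ 2).toNNReal) a
  rw [← h1, Measure.map_map (by fun_prop) (by fun_prop)] at h2
  simpa [Function.comp_def] using h2

lemma integrable_sq_stdGaussian : Integrable (fun g : ℝ => g ^ 2) stdGaussian :=
  (memLp_id_gaussianReal 2).integrable_sq

lemma integrable_id_stdGaussian : Integrable (fun g : ℝ => g) stdGaussian :=
  (memLp_id_gaussianReal (μ := 0) (v := 1) 1).integrable le_rfl

lemma integral_sq_stdGaussian : ∫ g : ℝ, g ^ 2 ∂stdGaussian = 1 := by
  have h := variance_fun_id_gaussianReal (μ := 0) (v := 1)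
  rw [variance_eq_integral (by fun_prop)] at h
  simpa using h

lemma integral_abs_stdGaussian_le : ∫ g : ℝ, |g| ∂stdGaussian ≤ 1 := by
  calc ∫ g : ℝ, |g| ∂stdGaussian ≤ ∫ g : ℝ, (1 / 2 + 1 / 2 * g ^ 2) ∂stdGaussian := by
        refine integral_mono integrable_id_stdGaussian.abs
          ((integrable_const _).add (integrable_sq_stdGaussian.const_mul _)) fun g => ?_
        change |g| ≤ 1 / 2 + 1 / 2 * g ^ 2
        nlinarith [sq_nonneg (|g| - 1), sq_abs g]
    _ = 1 := by
        rw [integral_add (integrable_const _) (integrable_sq_stdGaussian.const_mul _),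
          integral_const_mul, integral_sq_stdGaussian]
        simp; norm_num

lemma integrable_linear_growth {h : ℝ → ℝ} (hm : Measurable h) {H : ℝ}
    (hH : ∀ g, |h g| ≤ H * (1 + |g|)) (a t : ℝ) :
    Integrable (fun g => h (a + t * g)) stdGaussian := by
  have hi : Integrable (fun g : ℝ => H * (1 + |a + t * g|)) stdGaussian :=
    ((integrable_const _).add
      ((integrable_const _).add (integrable_id_stdGaussian.const_mul t)).abs).const_mul H
  exact hi.mono' (hm.comp (by fun_prop)).aestronglyMeasurable (ae_of_all _ fun g => hH _)

lemma abs_integral_linear_growth_le {h : ℝ → ℝ} (hm : Measurable h) {H : ℝ} (hH0 : 0 ≤ H)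
    (hH : ∀ g, |h g| ≤ H * (1 + |g|)) (a t : ℝ) :
    |∫ g, h (a + t * g) ∂stdGaussian| ≤ H * (1 + |a| + |t|) := by
  have hb : Integrable (fun g : ℝ => H * (1 + |a| + |t| * |g|)) stdGaussian :=
    ((integrable_const _).add (integrable_id_stdGaussian.abs.const_mul _)).const_mul H
  calc |∫ g, h (a + t * g) ∂stdGaussian| ≤ ∫ g, |h (a + t * g)| ∂stdGaussian :=
        abs_integral_le_integral_abs
    _ ≤ ∫ g, H * (1 + |a| + |t| * |g|) ∂stdGaussian := by
        refine integral_mono (integrable_linear_growth hm hH a t).abs hb fun g => ?_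
        refine (hH _).trans ?_
        have := abs_add_le a (t * g)
        rw [abs_mul] at this
        change H * (1 + |a + t * g|) ≤ H * (1 + |a| + |t| * |g|)
        refine mul_le_mul_of_nonneg_left ?_ hH0
        linarith
    _ = H * (1 + |a| + |t| * ∫ g, |g| ∂stdGaussian) := by
        rw [integral_const_mul, integral_add (integrable_const _)
          (integrable_id_stdGaussian.abs.const_mul _), integral_const_mul]
        simp
    _ ≤ H * (1 + |a| + |t| * 1) := by
        gcongr
        exact integral_abs_stdGaussian_le
    _ = _ := by ring

/-- Lipschitz dependence of Gaussian expectations on the mean and the standard deviation, for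
test functions that are merely measurable and of linear growth. -/
theorem exists_abs_integral_gaussian_sub_le :
    ∃ C : ℝ, 0 < C ∧ ∀ (h : ℝ → ℝ) (H δ t : ℝ), Measurable h → 0 ≤ H →
      (∀ g, |h g| ≤ H * (1 + |g|)) →
      |∫ g, h g ∂stdGaussian - ∫ g, h (δ + t * g) ∂stdGaussian| ≤ C * H * (|δ| + |t - 1|) := by
  set I := ∫ g : ℝ, (1 + |g|) ^ 3 * Real.exp (-(1 / 4) * g ^ 2) with hI
  have hI0 : 0 ≤ I := integral_nonneg fun g => by positivity
  -- `8 I` serves close parameters; `4 + u ≤ 129 u` for the distant ones, where `u > 1 / 32`.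
  refine ⟨8 * I + 129, by positivity, fun h H δ t hm hH0 hH => ?_⟩
  have hu0 : 0 ≤ |δ| + |t - 1| := by positivity
  rcases le_or_gt (|δ| + |t - 1|) (1 / 32) with hu | hu
  · have ht0 : 0 < t := by
      have := abs_nonneg δ
      have := (abs_le.1 (by linarith : |t - 1| ≤ 1 / 32)).1
      linarith
    have hv : (t ^ 2).toNNReal ≠ 0 := by simpa using ne_of_gt ‹0 < t›
    have e1 : ∫ g, h (δ + t * g) ∂stdGaussian =
        ∫ g, gaussianPDFReal δ (t ^ 2).toNNReal g * h g := by
      rw [← integral_map (f := h) (φ := fun g => δ + t * g) (by fun_prop)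
        hm.aestronglyMeasurable, stdGaussian_map_affine, integral_gaussianReal_eq_integral_smul hv]
      simp
    have e2 : ∫ g, h g ∂stdGaussian = ∫ g, gaussianPDFReal 0 1 g * h g := by
      rw [integral_gaussianReal_eq_integral_smul one_ne_zero]
      simp
    have hint : ∀ a t : ℝ, 0 < t →
        Integrable (fun g => gaussianPDFReal a (t ^ 2).toNNReal g * h g) := by
      intro a t ht
      have hv : (t ^ 2).toNNReal ≠ 0 := by simpa using ne_of_gt ‹0 < t›
      have := integrable_linear_growth hm hH a t
      rw [show (fun g => h (a + t * g)) = h ∘ (fun g => a + t * g) from rfl,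
        ← integrable_map_measure hm.aestronglyMeasurable (by fun_prop), stdGaussian_map_affine,
        gaussianReal_of_var_ne_zero _ hv,
        integrable_withDensity_iff_integrable_smul' (measurable_gaussianPDF _ _)
          (ae_of_all _ fun x => gaussianPDF_lt_top)] at this
      simpa [toReal_gaussianPDF] using this
    have hint1 : Integrable (fun g => gaussianPDFReal 0 1 g * h g) := by
      simpa using hint 0 1 one_pos
    rw [e1, e2, ← integral_sub hint1 (hint δ t ht0)]
    calc |∫ g, (gaussianPDFReal 0 1 g * h g - gaussianPDFReal δ (t ^ 2).toNNReal g * h g)|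
        ≤ ∫ g, |gaussianPDFReal 0 1 g * h g - gaussianPDFReal δ (t ^ 2).toNNReal g * h g| :=
          abs_integral_le_integral_abs
      _ ≤ ∫ g, (8 * H * (|δ| + |t - 1|)) * ((1 + |g|) ^ 3 * Real.exp (-(1 / 4) * g ^ 2)) := by
          refine integral_mono (hint1.sub (hint δ t ht0)).abs
            (integrable_one_add_abs_pow_mul_exp.const_mul _) fun g => ?_
          change |gaussianPDFReal 0 1 g * h g - gaussianPDFReal δ (t ^ 2).toNNReal g * h g| ≤ _
          rw [← sub_mul, abs_mul, abs_sub_comm]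
          calc _ ≤ (8 * (|δ| + |t - 1|) * ((1 + |g|) ^ 2 * Real.exp (-(1 / 4) * g ^ 2))) *
                (H * (1 + |g|)) := by
                gcongr
                · exact abs_gaussianPDFReal_sub_le hu g
                · exact hH g
            _ = _ := by ring
      _ = 8 * H * (|δ| + |t - 1|) * I := by rw [integral_const_mul]
      _ ≤ _ := by nlinarith [mul_nonneg hH0 hu0]
  · -- for distant parameters both expectations are bounded by first moments
    have h1 := abs_integral_linear_growth_le hm hH0 hH 0 1
    have h2 := abs_integral_linear_growth_le hm hH0 hH δ t
    simp only [zero_add, one_mul, abs_zero, add_zero, abs_one] at h1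
    have h3 : |t| ≤ 1 + |t - 1| := by
      have := abs_add_le 1 (t - 1)
      simpa using this
    calc _ ≤ |∫ g, h g ∂stdGaussian| + |∫ g, h (δ + t * g) ∂stdGaussian| := abs_sub _ _
      _ ≤ H * (1 + 1) + H * (1 + |δ| + (1 + |t - 1|)) := by
          refine add_le_add h1 (h2.trans ?_)
          gcongr
      _ = H * (4 + (|δ| + |t - 1|)) := by ring
      _ ≤ H * (129 * (|δ| + |t - 1|)) := by
          gcongr
          linarith
      _ ≤ _ := by nlinarith [mul_nonneg (mul_nonneg hI0 hH0) hu0]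

/-! ### The Markov decision process: measurability and growth of values -/

section MDP

variable {K : ℕ}

/-- Uniform bounds on the parameters of all arms. -/
structure Params.Bounded (M : Params K) (ρ Λ β : ℝ) : Prop where
  γ_nonneg : ∀ k, 0 ≤ M.γ k
  γ_le : ∀ k, M.γ k ≤ ρ
  lam_nonneg : ∀ k, 0 ≤ M.lam k
  lam_le : ∀ k, M.lam k ≤ Λ
  abs_b_le : ∀ k, |M.b k| ≤ β

/-- Mean of the satiation influence observed when arm `k` is pulled in state `x`. -/
def influenceMean (M : Params K) (x : State K) (k : Fin K) : ℝ :=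
  if (x k).2 = 0 then 0 else M.γ k ^ (x k).2 * ((x k).1 + M.lam k)

/-- Standard deviation of the satiation influence observed when arm `k` is pulled in state `x`. -/
def influenceSd (σ : ℝ) (M : Params K) (x : State K) (k : Fin K) : ℝ :=
  if (x k).2 = 0 then 0
  else √(M.lam k ^ 2 * σ ^ 2 * ∑ i ∈ Finset.range (x k).2, M.γ k ^ (2 * i))

lemma influenceVar_nonneg (σ : ℝ) (M : Params K) (k : Fin K) (n : ℕ) :
    0 ≤ M.lam k ^ 2 * σ ^ 2 * ∑ i ∈ Finset.range n, M.γ k ^ (2 * i) := by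
  refine mul_nonneg (by positivity) (Finset.sum_nonneg fun i _ => ?_)
  rw [pow_mul]
  positivity

lemma influenceSd_nonneg (σ : ℝ) (M : Params K) (x : State K) (k : Fin K) :
    0 ≤ influenceSd σ M x k := by
  unfold influenceSd
  split_ifs <;> positivity

/-- Every influence law, the degenerate one of a first pull included, is an affine image of the
standard Gaussian; so all transition kernels are driven by one fixed probability measure. -/
lemma influenceLaw_eq_map (σ : ℝ) (M : Params K) (x : State K) (k : Fin K) :
    influenceLaw σ M x k =
      stdGaussian.map (fun g => influenceMean M x k + influenceSd σ M x k * g) := by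
  rw [stdGaussian_map_affine]
  unfold influenceLaw influenceMean influenceSd
  split_ifs with h
  · simp
  · rw [Real.sq_sqrt (influenceVar_nonneg σ M k _)]

lemma measurable_nextState (k : Fin K) :
    Measurable (fun p : State K × ℝ => nextState p.1 k p.2) := by
  have hf : Measurable (fun n : ℕ => if n = 0 then 0 else n + 1) := measurable_of_countable _
  refine measurable_pi_lambda _ fun j => ?_
  unfold nextState
  by_cases h : j = k
  · simp only [h, if_true]
    fun_prop
  · simp only [h, if_false]
    exact (by fun_prop : Measurable fun p : State K × ℝ => (p.1 j).1).prodMk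
      (hf.comp (by fun_prop : Measurable fun p : State K × ℝ => (p.1 j).2))

lemma measurable_nextState_right (x : State K) (k : Fin K) : Measurable (nextState x k) :=
  (measurable_nextState k).comp (by fun_prop : Measurable fun y : ℝ => (x, y))

lemma integral_transition (σ : ℝ) (M : Params K) (x : State K) (k : Fin K) {f : State K → ℝ}
    (hf : Measurable f) :
    ∫ x', f x' ∂(transition σ M x k) =
      ∫ g, f (nextState x k (influenceMean M x k + influenceSd σ M x k * g)) ∂stdGaussian := by
  have hn := measurable_nextState_right x k
  rw [transition, integral_map hn.aemeasurable hf.aestronglyMeasurable, influenceLaw_eq_map,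
    integral_map (f := fun y => f (nextState x k y)) (by fun_prop)
      (hf.comp hn).aestronglyMeasurable]

lemma measurable_comp_arm (k : Fin K) (F : ℕ → ℝ → ℝ) (hF : ∀ n, Measurable (F n)) :
    Measurable (fun x : State K => F (x k).2 (x k).1) := by
  have h : Measurable (fun p : ℝ × ℕ => F p.2 p.1) := measurable_from_prod_countable_left hF
  exact h.comp (measurable_pi_apply k)

lemma measurable_influenceMean (M : Params K) (k : Fin K) :
    Measurable (fun x => influenceMean M x k) := by
  refine measurable_comp_arm k
    (fun n y => if n = 0 then 0 else M.γ k ^ n * (y + M.lam k)) fun n => ?_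
  by_cases h : n = 0
  · simp [h]
  · simp only [h, if_false]
    fun_prop

lemma measurable_influenceSd (σ : ℝ) (M : Params K) (k : Fin K) :
    Measurable (fun x => influenceSd σ M x k) :=
  measurable_comp_arm k (fun n _ => if n = 0 then 0
    else √(M.lam k ^ 2 * σ ^ 2 * ∑ i ∈ Finset.range n, M.γ k ^ (2 * i)))
    fun _ => measurable_const

lemma measurable_reward (M : Params K) (k : Fin K) : Measurable (fun x => reward M x k) := by
  refine measurable_comp_arm k (fun n y => if n = 0 then M.b k
    else M.b k - M.γ k ^ n * y - M.lam k * M.γ k ^ n) fun n => ?_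
  by_cases h : n = 0
  · simp [h]
  · simp only [h, if_false]
    fun_prop

/-- Expected total reward when arm `k` is pulled in state `x` and `f` is the value of the state
that follows. -/
def actionValue (σ : ℝ) (M : Params K) (f : State K → ℝ) (x : State K) (k : Fin K) : ℝ :=
  reward M x k + ∫ x', f x' ∂(transition σ M x k)

lemma measurable_actionValue (σ : ℝ) (M : Params K) {f : State K → ℝ} (hf : Measurable f)
    (k : Fin K) : Measurable (fun x => actionValue σ M f x k) := by
  refine (measurable_reward M k).add ?_
  simp only [integral_transition σ M _ k hf]
  have h : Measurable (fun p : State K × ℝ =>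
      f (nextState p.1 k (influenceMean M p.1 k + influenceSd σ M p.1 k * p.2))) := by
    refine hf.comp ((measurable_nextState k).comp (measurable_fst.prodMk ?_))
    exact ((measurable_influenceMean M k).comp measurable_fst).add
      (((measurable_influenceSd σ M k).comp measurable_fst).mul measurable_snd)
  exact (h.stronglyMeasurable.integral_prod_right (ν := stdGaussian)).measurable

lemma measurable_actionValue_policy (σ : ℝ) (M : Params K) {f : State K → ℝ} (hf : Measurable f)
    {π : State K → Fin K} (hπ : Measurable π) :
    Measurable (fun x => actionValue σ M f x (π x)) := by
  have h : Measurable (fun p : State K × Fin K => actionValue σ M f p.1 p.2) :=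
    measurable_from_prod_countable_left fun k => measurable_actionValue σ M hf k
  exact h.comp (measurable_id.prodMk hπ)

lemma valueAux_succ (σ : ℝ) (M : Params K) (π : Policy K) (r t : ℕ) (x : State K) :
    valueAux σ M π (r + 1) t x = actionValue σ M (valueAux σ M π r (t + 1)) x (π t x) := rfl

lemma measurable_valueAux (σ : ℝ) (M : Params K) {π : Policy K} (hπ : ∀ t, Measurable (π t)) :
    ∀ r t, Measurable (valueAux σ M π r t)
  | 0, _ => measurable_const
  | r + 1, t => by
      simp only [funext fun x => valueAux_succ σ M π r t x]
      exact measurable_actionValue_policy σ M (measurable_valueAux σ M hπ r (t + 1)) (hπ t)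

/-- Total size of the satiation influences in a state. -/
def load (x : State K) : ℝ := ∑ k, |(x k).1|

lemma load_nonneg (x : State K) : 0 ≤ load x := Finset.sum_nonneg fun _ _ => abs_nonneg _

lemma abs_le_load (x : State K) (k : Fin K) : |(x k).1| ≤ load x :=
  Finset.single_le_sum (f := fun k => |(x k).1|) (fun _ _ => abs_nonneg _) (Finset.mem_univ k)

@[simp] lemma load_initState : load (initState K) = 0 := by simp [load, initState]

lemma load_nextState (x : State K) (k : Fin K) (y : ℝ) :
    load (nextState x k y) = load x - |(x k).1| + |y| := by
  unfold load nextState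
  rw [← Finset.add_sum_erase _ _ (Finset.mem_univ k),
    ← Finset.add_sum_erase _ (fun k => |(x k).1|) (Finset.mem_univ k)]
  have : ∑ j ∈ Finset.univ.erase k, |(if j = k then (y, 1)
      else ((x j).1, if (x j).2 = 0 then 0 else (x j).2 + 1) : ℝ × ℕ).1| =
      ∑ j ∈ Finset.univ.erase k, |(x j).1| :=
    Finset.sum_congr rfl fun j hj => by simp [(Finset.mem_erase.1 hj).1]
  rw [this]
  simp
  ring

/-- A bound on the root mean square of the influence that a pull in the zero state creates,
for parameters bounded by `ρ` and `Λ`. The summand `1` keeps it positive when `Λ = 0`. -/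
def driftConst (σ ρ Λ : ℝ) : ℝ := Λ + Λ * σ / (1 - ρ) + 1

/-- The Lyapunov function of the analysis with `r` steps to go. Pulling arm `k` damps `|x k|` by the
factor `ρ`, which pays for the rewards and errors proportional to `|x k|`; the term linear in `r`
pays for those that do not depend on the state. -/
def potential (c : ℝ) (r : ℕ) (x : State K) : ℝ := (c + 1) * r + load x

lemma potential_nonneg {c : ℝ} (hc : 0 ≤ c) (r : ℕ) (x : State K) : 0 ≤ potential c r x := by
  have := load_nonneg x
  unfold potential
  positivity

lemma geom_sum_sq_le {q : ℝ} (hq0 : 0 ≤ q) {ρ : ℝ} (hq : q ≤ ρ) (hρ : ρ < 1) (n : ℕ) :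
    ∑ i ∈ Finset.range n, q ^ (2 * i) ≤ 1 / (1 - ρ) := by
  have h1 : 0 < 1 - ρ := by linarith
  rw [le_div_iff₀ h1]
  have h2 : ∑ i ∈ Finset.range n, q ^ (2 * i) ≤ ∑ i ∈ Finset.range n, q ^ i :=
    Finset.sum_le_sum fun i _ => pow_le_pow_of_le_one hq0 (by linarith) (by omega)
  have h3 := geom_sum_mul_neg q n
  have h4 : 0 ≤ q ^ n := by positivity
  have h5 : 0 ≤ ∑ i ∈ Finset.range n, q ^ i := Finset.sum_nonneg fun i _ => by positivity
  nlinarith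

section Bounded

variable {σ ρ Λ β : ℝ} {M : Params K}

lemma driftConst_pos (hσ : 0 < σ) (hρ : ρ < 1) (hΛ : 0 ≤ Λ) : 1 ≤ driftConst σ ρ Λ := by
  have : 0 ≤ Λ * σ / (1 - ρ) := div_nonneg (by positivity) (by linarith)
  unfold driftConst
  linarith

lemma Params.Bounded.influenceVar_le (hM : M.Bounded ρ Λ β) (hρ : ρ < 1)
    (k : Fin K) (n : ℕ) :
    M.lam k ^ 2 * σ ^ 2 * ∑ i ∈ Finset.range n, M.γ k ^ (2 * i) ≤ (Λ * σ / (1 - ρ)) ^ 2 := by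
  have h0 := hM.lam_nonneg k
  have h1 : 0 < 1 - ρ := by linarith
  have hρ0 : 0 ≤ ρ := (hM.γ_nonneg k).trans (hM.γ_le k)
  calc _ ≤ Λ ^ 2 * σ ^ 2 * (1 / (1 - ρ)) := by
        have := hM.lam_le k
        have := geom_sum_sq_le (hM.γ_nonneg k) (hM.γ_le k) hρ n
        have : 0 ≤ ∑ i ∈ Finset.range n, M.γ k ^ (2 * i) :=
          Finset.sum_nonneg fun i _ => pow_nonneg (hM.γ_nonneg k) _
        gcongr
    _ ≤ Λ ^ 2 * σ ^ 2 * (1 / (1 - ρ) ^ 2) := by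
        gcongr
        nlinarith
    _ = _ := by field_simp

lemma Params.Bounded.influenceSd_le (hM : M.Bounded ρ Λ β) (hσ : 0 < σ) (hρ : ρ < 1) (hΛ : 0 ≤ Λ)
    (x : State K) (k : Fin K) : influenceSd σ M x k ≤ Λ * σ / (1 - ρ) := by
  have h : 0 ≤ Λ * σ / (1 - ρ) := div_nonneg (by positivity) (by linarith)
  unfold influenceSd
  split_ifs
  · exact h
  · exact Real.sqrt_le_iff.2 ⟨h, hM.influenceVar_le hρ k _⟩

lemma Params.Bounded.abs_influenceMean_le (hM : M.Bounded ρ Λ β) (hρ : ρ < 1) (hΛ : 0 ≤ Λ)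
    (x : State K) (k : Fin K) : |influenceMean M x k| ≤ ρ * |(x k).1| + Λ := by
  have hγ0 := hM.γ_nonneg k
  have hρ0 : 0 ≤ ρ := hγ0.trans (hM.γ_le k)
  unfold influenceMean
  split_ifs with h
  · simp; positivity
  · have h1 : M.γ k ^ (x k).2 ≤ ρ :=
      (pow_le_of_le_one hγ0 ((hM.γ_le k).trans hρ.le) h).trans (hM.γ_le k)
    have h2 : |(x k).1 + M.lam k| ≤ |(x k).1| + Λ := by
      refine (abs_add_le _ _).trans ?_
      rw [abs_of_nonneg (hM.lam_nonneg k)]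
      linarith [hM.lam_le k]
    rw [abs_mul, abs_of_nonneg (by positivity)]
    calc _ ≤ ρ * (|(x k).1| + Λ) := by gcongr
      _ ≤ _ := by nlinarith

lemma Params.Bounded.abs_reward_le (hM : M.Bounded ρ Λ β) (hρ : ρ < 1) (hΛ : 0 ≤ Λ)
    (x : State K) (k : Fin K) : |reward M x k| ≤ β + Λ + |(x k).1| := by
  have hγ0 := hM.γ_nonneg k
  have hb := hM.abs_b_le k
  unfold reward
  split_ifs with h
  · linarith [abs_nonneg (x k).1]
  · have h1 : M.γ k ^ (x k).2 ≤ 1 := pow_le_one₀ hγ0 ((hM.γ_le k).trans hρ.le)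
    have h0 : 0 ≤ M.γ k ^ (x k).2 := by positivity
    have hl := hM.lam_nonneg k
    refine (abs_sub _ _).trans ((add_le_add_left (abs_sub _ _) _).trans ?_)
    rw [abs_mul, abs_of_nonneg h0, abs_of_nonneg (mul_nonneg hl h0)]
    have := hM.lam_le k
    nlinarith [abs_nonneg (x k).1]

lemma Params.Bounded.influence_sq_le (hM : M.Bounded ρ Λ β) (hσ : 0 < σ) (hρ : ρ < 1)
    (hΛ : 0 ≤ Λ) (x : State K) (k : Fin K) :
    influenceMean M x k ^ 2 + influenceSd σ M x k ^ 2 ≤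
      (ρ * |(x k).1| + driftConst σ ρ Λ) ^ 2 := by
  have h1 := hM.abs_influenceMean_le hρ hΛ x k
  have h2 := hM.influenceSd_le hσ hρ hΛ x k
  have h3 := influenceSd_nonneg σ M x k
  have h4 := abs_nonneg (influenceMean M x k)
  have h5 : 0 ≤ Λ * σ / (1 - ρ) := h3.trans h2
  rw [← sq_abs (influenceMean M x k)]
  calc _ ≤ (|influenceMean M x k| + influenceSd σ M x k) ^ 2 := by nlinarith
    _ ≤ _ := by
      refine pow_le_pow_left₀ (by positivity) ?_ 2
      unfold driftConst
      linarith

lemma integrable_add_abs_sq (a μ s : ℝ) :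
    Integrable (fun g : ℝ => (a + |μ + s * g|) ^ 2) stdGaussian := by
  have h : MemLp (fun g : ℝ => g) 2 stdGaussian := memLp_id_gaussianReal' 2 (by simp)
  exact ((memLp_const a).add ((memLp_const μ).add (h.const_mul s)).abs).integrable_sq

lemma integral_add_abs_sq_le {a m μ s : ℝ} (ha : 0 ≤ a) (hm : 0 < m) (h : μ ^ 2 + s ^ 2 ≤ m ^ 2) :
    ∫ g, (a + |μ + s * g|) ^ 2 ∂stdGaussian ≤ (a + m) ^ 2 := by
  have hy : Integrable (fun g : ℝ => (μ + s * g) ^ 2) stdGaussian := by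
    simpa using integrable_add_abs_sq 0 μ s
  have hy2 : ∫ g : ℝ, (μ + s * g) ^ 2 ∂stdGaussian = μ ^ 2 + s ^ 2 := by
    have e : (fun g : ℝ => (μ + s * g) ^ 2) =
        fun g => (μ ^ 2 + (2 * μ * s) * g) + s ^ 2 * g ^ 2 := by
      ext g; ring
    have h1 : Integrable (fun g : ℝ => μ ^ 2 + (2 * μ * s) * g) stdGaussian :=
      (integrable_const _).add (integrable_id_stdGaussian.const_mul _)
    rw [e, integral_add h1 (integrable_sq_stdGaussian.const_mul _), integral_add
      (integrable_const _) (integrable_id_stdGaussian.const_mul _), integral_const_mul,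
      integral_const_mul, integral_sq_stdGaussian, integral_id_gaussianReal]
    simp
  -- the cross term is bounded by `2 |y| ≤ m + y ^ 2 / m`
  calc ∫ g, (a + |μ + s * g|) ^ 2 ∂stdGaussian
      ≤ ∫ g, ((a ^ 2 + a * m) + (a / m + 1) * (μ + s * g) ^ 2) ∂stdGaussian := by
        refine integral_mono (integrable_add_abs_sq a μ s)
          ((integrable_const _).add (hy.const_mul _)) fun g => ?_
        have h1 : 2 * |μ + s * g| ≤ m + (μ + s * g) ^ 2 / m := by
          rw [← sub_nonneg]
          have : m + (μ + s * g) ^ 2 / m - 2 * |μ + s * g| = (m - |μ + s * g|) ^ 2 / m := by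
            rw [← sq_abs (μ + s * g)]
            field_simp
            ring
          rw [this]
          positivity
        have h2 : a / m * (μ + s * g) ^ 2 = a * ((μ + s * g) ^ 2 / m) := by ring
        change (a + |μ + s * g|) ^ 2 ≤ (a ^ 2 + a * m) + (a / m + 1) * (μ + s * g) ^ 2
        nlinarith [sq_abs (μ + s * g)]
    _ = (a ^ 2 + a * m) + (a / m + 1) * (μ ^ 2 + s ^ 2) := by
        rw [integral_add (integrable_const _) (hy.const_mul _), integral_const_mul, hy2]
        simp
    _ ≤ (a ^ 2 + a * m) + (a / m + 1) * m ^ 2 := by gcongr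
    _ = _ := by field_simp

lemma integrable_add_abs (a μ s : ℝ) :
    Integrable (fun g : ℝ => a + |μ + s * g|) stdGaussian :=
  (integrable_const _).add ((integrable_const _).add (integrable_id_stdGaussian.const_mul _)).abs

lemma integral_add_abs_le {a m μ s : ℝ} (hm : 0 < m) (h : μ ^ 2 + s ^ 2 ≤ m ^ 2) :
    ∫ g, (a + |μ + s * g|) ∂stdGaussian ≤ a + m := by
  have hy : Integrable (fun g : ℝ => |μ + s * g|) stdGaussian := by
    simpa using integrable_add_abs 0 μ s
  have hle : ∫ g, |μ + s * g| ∂stdGaussian ≤ m := by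
    have h3 : (∫ g, |μ + s * g| ∂stdGaussian) ^ 2 ≤ m ^ 2 := by
      have h4 : 0 ≤ variance (fun g => |μ + s * g|) stdGaussian := variance_nonneg _ _
      have h5 : MemLp (fun g => |μ + s * g|) 2 stdGaussian := by
        have h : MemLp (fun g : ℝ => g) 2 stdGaussian := memLp_id_gaussianReal' 2 (by simp)
        exact ((memLp_const μ).add (h.const_mul s)).abs
      rw [variance_eq_sub h5] at h4
      have h6 := integral_add_abs_sq_le le_rfl hm h
      simp only [zero_add] at h6
      simp only [Pi.pow_apply] at h4
      linarith
    exact abs_le_of_sq_le_sq h3 hm.le |> fun h => (abs_le.1 (by simpa using h)).2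
  rw [integral_add (integrable_const _) hy]
  simpa using hle

/-- The expected potential after a pull of arm `k` is at most the potential before the pull minus a
gain of order `1 + |x k|`, and the expected squared potential is at most the square of that. -/
lemma integral_potential_nextState_le (hM : M.Bounded ρ Λ β) (hσ : 0 < σ) (hρ : ρ < 1)
    (hΛ : 0 ≤ Λ) (r : ℕ) (x : State K) (k : Fin K) :
    ∫ g, potential (driftConst σ ρ Λ) r
        (nextState x k (influenceMean M x k + influenceSd σ M x k * g)) ∂stdGaussian ≤
      potential (driftConst σ ρ Λ) (r + 1) x - (1 + (1 - ρ) * |(x k).1|) ∧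
    ∫ g, potential (driftConst σ ρ Λ) r
        (nextState x k (influenceMean M x k + influenceSd σ M x k * g)) ^ 2 ∂stdGaussian ≤
      (potential (driftConst σ ρ Λ) (r + 1) x - (1 + (1 - ρ) * |(x k).1|)) ^ 2 := by
  have hc := driftConst_pos hσ hρ hΛ
  set c := driftConst σ ρ Λ with hcdef
  have hρ0 : 0 ≤ ρ := (hM.γ_nonneg k).trans (hM.γ_le k)
  have hsq := hM.influence_sq_le hσ hρ hΛ x k
  have hm : 0 < ρ * |(x k).1| + c := by positivity
  have ha : 0 ≤ (c + 1) * r + (load x - |(x k).1|) := by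
    have := abs_le_load x k
    have : 0 ≤ load x - |(x k).1| := by linarith
    positivity
  have e : ∀ y : ℝ, potential c r (nextState x k y) =
      ((c + 1) * r + (load x - |(x k).1|)) + |y| := fun y => by
    rw [potential, load_nextState]; ring
  have e2 : potential c (r + 1) x - (1 + (1 - ρ) * |(x k).1|) =
      ((c + 1) * r + (load x - |(x k).1|)) + (ρ * |(x k).1| + c) := by
    rw [potential]; push_cast; ring
  simp only [e, e2]
  exact ⟨integral_add_abs_le hm hsq, integral_add_abs_sq_le ha hm hsq⟩

lemma integrable_potential_nextState (c : ℝ) (r : ℕ) (x : State K) (k : Fin K) (μ s : ℝ) :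
    Integrable (fun g => potential c r (nextState x k (μ + s * g))) stdGaussian ∧
    Integrable (fun g => potential c r (nextState x k (μ + s * g)) ^ 2) stdGaussian := by
  have e : ∀ y : ℝ, potential c r (nextState x k y) =
      ((c + 1) * r + (load x - |(x k).1|)) + |y| := fun y => by
    rw [potential, load_nextState]; ring
  simp only [e]
  exact ⟨integrable_add_abs _ μ s, integrable_add_abs_sq _ μ s⟩

/-- The ratio by which value functions may exceed the potential. It is chosen such that the gain of
the potential in one step, times this ratio, covers the reward. -/
def valueConst (ρ Λ β : ℝ) : ℝ := (β + Λ + 1) / (1 - ρ)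

lemma integrable_of_abs_le_potential {c B : ℝ} {r : ℕ} {f : State K → ℝ} (hf : Measurable f)
    (hfb : ∀ x, |f x| ≤ B * potential c r x) (x : State K) (k : Fin K) (μ s : ℝ) :
    Integrable (fun g => f (nextState x k (μ + s * g))) stdGaussian := by
  refine ((integrable_potential_nextState c r x k μ s).1.const_mul B).mono' ?_
    (ae_of_all _ fun g => hfb _)
  exact (hf.comp ((measurable_nextState_right x k).comp (by fun_prop))).aestronglyMeasurable

lemma abs_actionValue_le (hM : M.Bounded ρ Λ β) (hσ : 0 < σ) (hρ : ρ < 1) (hΛ : 0 ≤ Λ)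
    {r : ℕ} {f : State K → ℝ} (hf : Measurable f)
    (hfb : ∀ x, |f x| ≤ valueConst ρ Λ β * potential (driftConst σ ρ Λ) r x)
    (x : State K) (k : Fin K) :
    |actionValue σ M f x k| ≤
      valueConst ρ Λ β * potential (driftConst σ ρ Λ) (r + 1) x := by
  have hβ : 0 ≤ β := (abs_nonneg _).trans (hM.abs_b_le k)
  have hρ0 : 0 ≤ ρ := (hM.γ_nonneg k).trans (hM.γ_le k)
  have h1ρ : 0 < 1 - ρ := by linarith
  have hB0 : 0 ≤ valueConst ρ Λ β := div_nonneg (by positivity) h1ρ.le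
  have hB1 : valueConst ρ Λ β * (1 - ρ) = β + Λ + 1 := div_mul_cancel₀ _ h1ρ.ne'
  have hB2 : β + Λ ≤ valueConst ρ Λ β := by nlinarith
  have h1 := hM.abs_reward_le hρ hΛ x k
  have h2 := (integral_potential_nextState_le hM hσ hρ hΛ r x k).1
  set μ := influenceMean M x k
  set s := influenceSd σ M x k
  have h3 : |∫ x', f x' ∂(transition σ M x k)| ≤ valueConst ρ Λ β *
      (potential (driftConst σ ρ Λ) (r + 1) x - (1 + (1 - ρ) * |(x k).1|)) := by
    rw [integral_transition σ M x k hf]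
    calc _ ≤ ∫ g, |f (nextState x k (μ + s * g))| ∂stdGaussian := abs_integral_le_integral_abs
      _ ≤ ∫ g, valueConst ρ Λ β *
          potential (driftConst σ ρ Λ) r (nextState x k (μ + s * g)) ∂stdGaussian :=
          integral_mono (integrable_of_abs_le_potential hf hfb x k μ s).abs
            ((integrable_potential_nextState _ r x k μ s).1.const_mul _) fun g => hfb _
      _ ≤ _ := by
          rw [integral_const_mul]
          gcongr
  refine (abs_add_le _ _).trans ?_
  nlinarith [abs_nonneg (x k).1]

lemma abs_valueAux_le (hM : M.Bounded ρ Λ β) (hσ : 0 < σ) (hρ : ρ < 1) (hΛ : 0 ≤ Λ)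
    {π : Policy K} (hπ : ∀ t, Measurable (π t)) :
    ∀ r t x, |valueAux σ M π r t x| ≤ valueConst ρ Λ β * potential (driftConst σ ρ Λ) r x
  | 0, t, x => by
      have hk : 0 < K := (π t x).pos
      have hβ : 0 ≤ β := (abs_nonneg _).trans (hM.abs_b_le (π t x))
      have := potential_nonneg (zero_le_one.trans (driftConst_pos hσ hρ hΛ)) 0 x
      have hB0 : 0 ≤ valueConst ρ Λ β := div_nonneg (by positivity) (by linarith)
      simpa [valueAux] using mul_nonneg hB0 this
  | r + 1, t, x =>
      abs_actionValue_le hM hσ hρ hΛ (measurable_valueAux σ M hπ r (t + 1))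
        (fun x => abs_valueAux_le hM hσ hρ hΛ hπ r (t + 1) x) x _

end Bounded

/-! ### Existence of optimal policies -/

lemma exists_measurable_argmax {α : Type*} [MeasurableSpace α] [Nonempty (Fin K)]
    (F : α → Fin K → ℝ) (hF : ∀ k, Measurable fun x => F x k) :
    ∃ π : α → Fin K, Measurable π ∧ ∀ x k, F x k ≤ F x (π x) := by
  have h : ∀ s : Finset (Fin K), ∃ π : α → Fin K, Measurable π ∧
      ∀ x, ∀ k ∈ s, F x k ≤ F x (π x) := by
    intro s
    induction s using Finset.induction_on with
    | empty => exact ⟨fun _ => Classical.arbitrary _, measurable_const, by simp⟩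
    | insert k s _ ih =>
      obtain ⟨π, hπ, hmax⟩ := ih
      have hFπ : Measurable fun x => F x (π x) :=
        (measurable_from_prod_countable_left hF : Measurable fun p : α × Fin K => F p.1 p.2).comp
          (measurable_id.prodMk hπ)
      refine ⟨fun x => if F x (π x) ≤ F x k then k else π x,
        Measurable.ite (measurableSet_le hFπ (hF k)) measurable_const hπ, fun x j hj => ?_⟩
      dsimp only
      rcases Finset.mem_insert.1 hj with rfl | hj
      · split_ifs with h
        · exact le_rfl
        · exact (not_le.1 h).le
      · split_ifs with h
        · exact (hmax x j hj).trans h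
        · exact hmax x j hj
  obtain ⟨π, hπ, hmax⟩ := h Finset.univ
  exact ⟨π, hπ, fun x k => hmax x k (Finset.mem_univ k)⟩

lemma actionValue_mono {σ : ℝ} {M : Params K} {c B : ℝ} {r : ℕ} {f f' : State K → ℝ}
    (hf : Measurable f) (hf' : Measurable f')
    (hfb : ∀ x, |f x| ≤ B * potential c r x) (hfb' : ∀ x, |f' x| ≤ B * potential c r x)
    (hle : ∀ x, f x ≤ f' x) (x : State K) (k : Fin K) :
    actionValue σ M f x k ≤ actionValue σ M f' x k := by
  unfold actionValue
  rw [integral_transition σ M x k hf, integral_transition σ M x k hf']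
  gcongr
  · exact integrable_of_abs_le_potential hf hfb x k _ _
  · exact integrable_of_abs_le_potential hf' hfb' x k _ _
  · exact fun g => hle _

/-- Optimal policies exist: with `r` steps to go, pull an arm that maximizes the action value for
the optimal value with `r - 1` steps to go. -/
theorem exists_isOptimal {σ ρ Λ β : ℝ} {M : Params K} (hK : 1 ≤ K) (hM : M.Bounded ρ Λ β)
    (hσ : 0 < σ) (hρ : ρ < 1) (hΛ : 0 ≤ Λ) (T : ℕ) : ∃ π, IsOptimal σ M T π := by
  have : Nonempty (Fin K) := ⟨⟨0, hK⟩⟩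
  -- `greedy f` maximizes the action values for the continuation value `f`; `V r` is the optimal
  -- value with `r` steps to go.
  have hg : ∀ f : State K → ℝ, ∃ π : State K → Fin K, Measurable f → Measurable π ∧
      ∀ x k, actionValue σ M f x k ≤ actionValue σ M f x (π x) := by
    intro f
    by_cases hf : Measurable f
    · obtain ⟨π, h⟩ := exists_measurable_argmax (fun x k => actionValue σ M f x k)
        (measurable_actionValue σ M hf)
      exact ⟨π, fun _ => h⟩
    · exact ⟨fun _ => Classical.arbitrary _, fun h => absurd h hf⟩
  choose greedy hgreedy using hg
  let V : ℕ → State K → ℝ := fun r =>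
    Nat.rec (fun _ => 0) (fun _ f x => actionValue σ M f x (greedy f x)) r
  have hV0 : V 0 = fun _ => 0 := rfl
  have hVs : ∀ r, V (r + 1) = fun x => actionValue σ M (V r) x (greedy (V r) x) := fun r => rfl
  have hVm : ∀ r, Measurable (V r) := by
    intro r
    induction r with
    | zero => rw [hV0]; exact measurable_const
    | succ r ih =>
      rw [hVs]
      exact measurable_actionValue_policy σ M ih (hgreedy _ ih).1
  let π : Policy K := fun t => greedy (V (T - t))
  have hπ : ∀ t, Measurable (π t) := fun t => (hgreedy _ (hVm _)).1
  have hval : ∀ r t, r + t = T + 1 → valueAux σ M π r t = V r := by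
    intro r
    induction r with
    | zero => intro t _; rfl
    | succ r ih =>
      intro t ht
      ext x
      rw [valueAux_succ, ih (t + 1) (by omega), hVs]
      simp only [π, show T - t = r by omega]
  have hub : ∀ π' : Policy K, (∀ t, Measurable (π' t)) → ∀ r t, r + t = T + 1 →
      ∀ x, valueAux σ M π' r t x ≤ V r x := by
    intro π' hπ' r
    induction r with
    | zero => intro t _ x; exact le_rfl
    | succ r ih =>
      intro t ht x
      have hle := ih (t + 1) (by omega)
      rw [valueAux_succ, hVs]
      refine le_trans ?_ ((hgreedy _ (hVm r)).2 x (π' t x))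
      rw [← hval r (t + 1) (by omega)] at hle ⊢
      exact actionValue_mono (measurable_valueAux σ M hπ' r (t + 1))
        (measurable_valueAux σ M hπ r (t + 1)) (abs_valueAux_le hM hσ hρ hΛ hπ' r (t + 1))
        (abs_valueAux_le hM hσ hρ hΛ hπ r (t + 1)) hle x _
  refine ⟨π, hπ, fun π' hπ' => ?_⟩
  unfold value
  rw [hval (T + 1 - 1) 1 (by omega)]
  exact hub π' hπ' _ _ (by omega) _

/-! ### Comparison of two Markov decision processes -/

lemma abs_pow_sub_pow_le {p q ρ : ℝ} (hp0 : 0 ≤ p) (hp : p ≤ ρ) (hq0 : 0 ≤ q) (hq : q ≤ ρ)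
    (hρ : ρ < 1) (n : ℕ) : |p ^ n - q ^ n| ≤ |p - q| / (1 - ρ) := by
  have h1 : 0 < 1 - ρ := by linarith
  induction n with
  | zero => simp; positivity
  | succ n ih =>
    have e : p ^ (n + 1) - q ^ (n + 1) = p * (p ^ n - q ^ n) + q ^ n * (p - q) := by ring
    rw [e]
    have hqn : q ^ n ≤ 1 := pow_le_one₀ hq0 (by linarith)
    have hqn0 : 0 ≤ q ^ n := by positivity
    have hρ0 : 0 ≤ ρ := hp0.trans hp
    calc |p * (p ^ n - q ^ n) + q ^ n * (p - q)|
        ≤ |p * (p ^ n - q ^ n)| + |q ^ n * (p - q)| := abs_add_le _ _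
      _ = p * |p ^ n - q ^ n| + q ^ n * |p - q| := by
          rw [abs_mul, abs_mul, abs_of_nonneg hp0, abs_of_nonneg hqn0]
      _ ≤ ρ * (|p - q| / (1 - ρ)) + 1 * |p - q| := by gcongr
      _ = _ := by field_simp; ring

lemma abs_geom_sum_sq_sub_le {p q ρ : ℝ} (hp0 : 0 ≤ p) (hp : p ≤ ρ) (hq0 : 0 ≤ q) (hq : q ≤ ρ)
    (hρ : ρ < 1) (n : ℕ) :
    |∑ i ∈ Finset.range n, p ^ (2 * i) - ∑ i ∈ Finset.range n, q ^ (2 * i)| ≤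
      2 * |p - q| / (1 - ρ) ^ 2 := by
  have h1 : 0 < 1 - ρ := by linarith
  have hρ0 : 0 ≤ ρ := hp0.trans hp
  induction n with
  | zero => simp; positivity
  | succ n ih =>
    have es : ∀ r : ℝ, ∑ i ∈ Finset.range (n + 1), r ^ (2 * i) =
        r ^ 2 * ∑ i ∈ Finset.range n, r ^ (2 * i) + 1 := fun r => by
      rw [Finset.sum_range_succ', Finset.mul_sum]
      simp only [mul_add, pow_add]
      simp [mul_comm]
    set S := ∑ i ∈ Finset.range n, p ^ (2 * i)
    have hS' := geom_sum_sq_le hq0 hq hρ n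
    have hS0 : 0 ≤ ∑ i ∈ Finset.range n, q ^ (2 * i) :=
      Finset.sum_nonneg fun i _ => pow_nonneg hq0 _
    set S' := ∑ i ∈ Finset.range n, q ^ (2 * i)
    have e : p ^ 2 * S + 1 - (q ^ 2 * S' + 1) =
        p ^ 2 * (S - S') + ((p + q) * S') * (p - q) := by ring
    rw [es, es, e]
    calc _ ≤ |p ^ 2 * (S - S')| + |((p + q) * S') * (p - q)| := abs_add_le _ _
      _ = p ^ 2 * |S - S'| + ((p + q) * S') * |p - q| := by
          rw [abs_mul, abs_mul, abs_of_nonneg (sq_nonneg p),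
            abs_of_nonneg (mul_nonneg (add_nonneg hp0 hq0) hS0)]
      _ ≤ ρ * (2 * |p - q| / (1 - ρ) ^ 2) + ((1 + 1) * (1 / (1 - ρ))) * |p - q| := by
          have : p ^ 2 ≤ ρ := by nlinarith
          gcongr <;> linarith
      _ = _ := by field_simp; ring

section Compare

variable {σ ρ Λ β ε : ℝ} {M M' : Params K}

/-- Lipschitz constant of rewards and of influence means in the parameters, relative to
`1 + |x k|`. -/
def meanConst (ρ Λ : ℝ) : ℝ := (Λ + 1) / (1 - ρ)

/-- Lipschitz constant of the influence variance in the parameters. -/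
def varConst (σ ρ Λ : ℝ) : ℝ := 2 * Λ * σ ^ 2 / (1 - ρ) + 2 * Λ ^ 2 * σ ^ 2 / (1 - ρ) ^ 2

/-- The parameters `M` and `M'` are bounded, have the same base rewards and are within `ε`. -/
structure Params.Close (M M' : Params K) (ρ Λ β ε : ℝ) : Prop where
  left : M.Bounded ρ Λ β
  right : M'.Bounded ρ Λ β
  γ : ∀ k, |M'.γ k - M.γ k| ≤ ε
  lam : ∀ k, |M'.lam k - M.lam k| ≤ ε
  b : ∀ k, M'.b k = M.b k

lemma Params.Close.affine_le (h : M.Close M' ρ Λ β ε) (hρ : ρ < 1) (k : Fin K) (n : ℕ) (y : ℝ) :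
    |M'.γ k ^ n * (y + M'.lam k) - M.γ k ^ n * (y + M.lam k)| ≤
      meanConst ρ Λ * ε * (1 + |y|) := by
  have h1 : 0 < 1 - ρ := by linarith
  have hγ := h.γ k
  have hε : 0 ≤ ε := (abs_nonneg _).trans hγ
  have hp := abs_pow_sub_pow_le (h.right.γ_nonneg k) (h.right.γ_le k) (h.left.γ_nonneg k)
    (h.left.γ_le k) hρ n
  have hp' : |M'.γ k ^ n - M.γ k ^ n| ≤ ε / (1 - ρ) := hp.trans (by gcongr)
  have hΛ := h.right.lam_le k
  have hl0 := h.right.lam_nonneg k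
  have hg1 : M.γ k ^ n ≤ 1 := pow_le_one₀ (h.left.γ_nonneg k) (by linarith [h.left.γ_le k])
  have hg0 : 0 ≤ M.γ k ^ n := pow_nonneg (h.left.γ_nonneg k) n
  have e : M'.γ k ^ n * (y + M'.lam k) - M.γ k ^ n * (y + M.lam k) =
      (M'.γ k ^ n - M.γ k ^ n) * (y + M'.lam k) + M.γ k ^ n * (M'.lam k - M.lam k) := by ring
  have hy : |y + M'.lam k| ≤ |y| + Λ := by
    refine (abs_add_le _ _).trans ?_
    rw [abs_of_nonneg hl0]
    linarith
  have hm : 1 ≤ 1 / (1 - ρ) := by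
    rw [le_div_iff₀ h1]
    linarith [(h.left.γ_nonneg k).trans (h.left.γ_le k)]
  rw [e]
  calc _ ≤ |(M'.γ k ^ n - M.γ k ^ n) * (y + M'.lam k)| + |M.γ k ^ n * (M'.lam k - M.lam k)| :=
        abs_add_le _ _
    _ = |M'.γ k ^ n - M.γ k ^ n| * |y + M'.lam k| + M.γ k ^ n * |M'.lam k - M.lam k| := by
        rw [abs_mul, abs_mul, abs_of_nonneg hg0]
    _ ≤ ε / (1 - ρ) * (|y| + Λ) + 1 * ε := by
        gcongr
        exact h.lam k
    _ = (1 / (1 - ρ)) * ε * (|y| + Λ) + 1 * ε := by ring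
    _ ≤ (1 / (1 - ρ)) * ε * (|y| + Λ) + (1 / (1 - ρ)) * ε := by gcongr
    _ = (1 / (1 - ρ)) * ε * (1 + |y| + Λ) := by ring
    _ ≤ (1 / (1 - ρ)) * ε * ((Λ + 1) * (1 + |y|)) := by
        have : 0 ≤ Λ * |y| := mul_nonneg (hl0.trans hΛ) (abs_nonneg y)
        gcongr
        linarith
    _ = _ := by unfold meanConst; ring

lemma Params.Close.abs_reward_sub_le (h : M.Close M' ρ Λ β ε) (hρ : ρ < 1) (hΛ : 0 ≤ Λ)
    (x : State K) (k : Fin K) :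
    |reward M x k - reward M' x k| ≤ meanConst ρ Λ * ε * (1 + |(x k).1|) := by
  have hε : 0 ≤ ε := (abs_nonneg _).trans (h.γ k)
  unfold reward
  split_ifs with h0
  · rw [h.b, sub_self, abs_zero]
    have : 0 ≤ meanConst ρ Λ := div_nonneg (by linarith) (by linarith)
    positivity
  · convert h.affine_le hρ k (x k).2 (x k).1 using 2
    rw [h.b]
    ring

lemma Params.Close.abs_var_sub_le (h : M.Close M' ρ Λ β ε) (hρ : ρ < 1) (k : Fin K) (n : ℕ) :
    |M'.lam k ^ 2 * σ ^ 2 * ∑ i ∈ Finset.range n, M'.γ k ^ (2 * i) -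
      M.lam k ^ 2 * σ ^ 2 * ∑ i ∈ Finset.range n, M.γ k ^ (2 * i)| ≤ varConst σ ρ Λ * ε := by
  have h1 : 0 < 1 - ρ := by linarith
  have hε : 0 ≤ ε := (abs_nonneg _).trans (h.γ k)
  have hs := abs_geom_sum_sq_sub_le (h.right.γ_nonneg k) (h.right.γ_le k) (h.left.γ_nonneg k)
    (h.left.γ_le k) hρ n
  have hS := geom_sum_sq_le (h.right.γ_nonneg k) (h.right.γ_le k) hρ n
  have hS0 : 0 ≤ ∑ i ∈ Finset.range n, M'.γ k ^ (2 * i) :=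
    Finset.sum_nonneg fun i _ => pow_nonneg (h.right.γ_nonneg k) _
  set S' := ∑ i ∈ Finset.range n, M'.γ k ^ (2 * i)
  set S := ∑ i ∈ Finset.range n, M.γ k ^ (2 * i)
  have hl := h.left.lam_nonneg k
  have hl' := h.right.lam_nonneg k
  have hL := h.left.lam_le k
  have hL' := h.right.lam_le k
  have e : M'.lam k ^ 2 * σ ^ 2 * S' - M.lam k ^ 2 * σ ^ 2 * S =
      (σ ^ 2 * ((M'.lam k + M.lam k) * S')) * (M'.lam k - M.lam k) +
        (M.lam k ^ 2 * σ ^ 2) * (S' - S) := by ring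
  rw [e]
  calc _ ≤ |(σ ^ 2 * ((M'.lam k + M.lam k) * S')) * (M'.lam k - M.lam k)| +
        |(M.lam k ^ 2 * σ ^ 2) * (S' - S)| := abs_add_le _ _
    _ = (σ ^ 2 * ((M'.lam k + M.lam k) * S')) * |M'.lam k - M.lam k| +
        (M.lam k ^ 2 * σ ^ 2) * |S' - S| := by
        rw [abs_mul, abs_mul (M.lam k ^ 2 * σ ^ 2),
          abs_of_nonneg (by positivity : 0 ≤ σ ^ 2 * ((M'.lam k + M.lam k) * S')),
          abs_of_nonneg (by positivity : 0 ≤ M.lam k ^ 2 * σ ^ 2)]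
    _ ≤ (σ ^ 2 * ((Λ + Λ) * (1 / (1 - ρ)))) * ε +
        (Λ ^ 2 * σ ^ 2) * (2 * ε / (1 - ρ) ^ 2) := by
        have := h.lam k
        have := hs.trans (by gcongr; exact h.γ k : _ ≤ 2 * ε / (1 - ρ) ^ 2)
        have : 0 ≤ Λ := hl.trans hL
        gcongr
    _ = _ := by unfold varConst; ring

lemma mul_sigma_le_influenceSd {ℓ : ℝ} (hσ : 0 < σ) (hℓ : 0 ≤ ℓ) (x : State K) (k : Fin K)
    (hγ : 0 ≤ M.γ k) (hlam : ℓ ≤ M.lam k) (hx : (x k).2 ≠ 0) :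
    ℓ * σ ≤ influenceSd σ M x k := by
  unfold influenceSd
  rw [if_neg hx]
  apply Real.le_sqrt_of_sq_le
  have h1 : 1 ≤ ∑ i ∈ Finset.range (x k).2, M.γ k ^ (2 * i) := by
    have := Finset.single_le_sum (f := fun i => M.γ k ^ (2 * i))
      (fun i _ => pow_nonneg hγ _) (Finset.mem_range.2 (Nat.pos_of_ne_zero hx))
    simpa using this
  calc (ℓ * σ) ^ 2 = ℓ ^ 2 * σ ^ 2 * 1 := by ring
    _ ≤ _ := by gcongr

/-- Replacing `M` by `M'` in one transition changes the expected continuation value by little, even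
though the continuation value is only measurable in the state. The Gaussian comparison is
applied in the coordinate that standardizes the transition of `M`. -/
lemma exists_abs_integral_transition_sub_le (σ ρ Λ ℓ : ℝ) (hσ : 0 < σ) (hρ : ρ < 1) (hΛ : 0 ≤ Λ)
    (hℓ : 0 < ℓ) (B : ℝ) (hB : 0 ≤ B) :
    ∃ C : ℝ, 0 < C ∧ ∀ (K : ℕ) (M M' : Params K) (β ε : ℝ), M.Close M' ρ Λ β ε →
      (∀ k, ℓ ≤ M.lam k) → ∀ (r : ℕ) (f : State K → ℝ), Measurable f →
      (∀ x, |f x| ≤ B * potential (driftConst σ ρ Λ) r x) → ∀ x k,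
      |∫ x', f x' ∂(transition σ M x k) - ∫ x', f x' ∂(transition σ M' x k)| ≤
        C * ε * ((1 + |(x k).1|) * potential (driftConst σ ρ Λ) (r + 1) x) := by
  obtain ⟨C, hC, hgauss⟩ := exists_abs_integral_gaussian_sub_le
  have h1ρ : 0 < 1 - ρ := by linarith
  have hm0 : 0 < meanConst ρ Λ := div_pos (by linarith) h1ρ
  have hv0 : 0 ≤ varConst σ ρ Λ := by unfold varConst; positivity
  set D := meanConst ρ Λ / (ℓ * σ) + varConst σ ρ Λ / (ℓ * σ) ^ 2 with hD
  have hD0 : 0 < D := by positivity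
  refine ⟨C * (B + 1) * D, by positivity, fun K M M' β ε h hlam r f hf hfb x k => ?_⟩
  have hε : 0 ≤ ε := (abs_nonneg _).trans (h.γ k)
  have hρ0 : 0 ≤ ρ := (h.left.γ_nonneg k).trans (h.left.γ_le k)
  have hc := driftConst_pos hσ hρ hΛ
  have hU : 0 ≤ potential (driftConst σ ρ Λ) (r + 1) x := potential_nonneg (by linarith) _ _
  rw [integral_transition σ M x k hf, integral_transition σ M' x k hf]
  by_cases hx : (x k).2 = 0
  · simp only [influenceMean, influenceSd, hx, if_true, sub_self, abs_zero]
    positivity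
  have hs := mul_sigma_le_influenceSd hσ hℓ.le x k (h.left.γ_nonneg k) (hlam k) hx
  have hμ : |influenceMean M' x k - influenceMean M x k| ≤
      meanConst ρ Λ * ε * (1 + |(x k).1|) := by
    simp only [influenceMean, hx, if_false]
    exact h.affine_le hρ k _ _
  have hvar : |influenceSd σ M' x k ^ 2 - influenceSd σ M x k ^ 2| ≤ varConst σ ρ Λ * ε := by
    simp only [influenceSd, hx, if_false]
    rw [Real.sq_sqrt (influenceVar_nonneg _ _ _ _), Real.sq_sqrt (influenceVar_nonneg _ _ _ _)]
    exact h.abs_var_sub_le hρ k _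
  have hmean := h.left.abs_influenceMean_le hρ hΛ x k
  have hsd := h.left.influenceSd_le hσ hρ hΛ x k
  have hs' := influenceSd_nonneg σ M' x k
  set μ := influenceMean M x k
  set μ' := influenceMean M' x k
  set s := influenceSd σ M x k
  set s' := influenceSd σ M' x k
  have hℓσ : 0 < ℓ * σ := by positivity
  have hs0 : 0 < s := hℓσ.trans_le hs
  have hfm : Measurable fun g => f (nextState x k (μ + s * g)) :=
    hf.comp ((measurable_nextState_right x k).comp (by fun_prop))
  have hgrowth : ∀ g, |f (nextState x k (μ + s * g))| ≤
      B * potential (driftConst σ ρ Λ) (r + 1) x * (1 + |g|) := by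
    intro g
    have hl := abs_le_load x k
    have h1 : |μ + s * g| ≤ |μ| + s * |g| := by
      simpa [abs_mul, abs_of_pos hs0] using abs_add_le μ (s * g)
    have h2 : potential (driftConst σ ρ Λ) r (nextState x k (μ + s * g)) ≤
        potential (driftConst σ ρ Λ) (r + 1) x * (1 + |g|) := by
      have h3 : |μ| + s ≤ ρ * |(x k).1| + driftConst σ ρ Λ := by
        unfold driftConst; linarith
      have h4 : s ≤ potential (driftConst σ ρ Λ) (r + 1) x := by
        have : 0 ≤ (driftConst σ ρ Λ + 1) * r := by positivity
        have : s ≤ driftConst σ ρ Λ := by unfold driftConst; linarith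
        unfold potential
        push_cast
        linarith [load_nonneg x]
      have h5 : potential (driftConst σ ρ Λ) r (nextState x k (μ + s * g)) ≤
          (driftConst σ ρ Λ + 1) * r + load x - |(x k).1| + |μ| + s * |g| := by
        rw [potential, load_nextState]
        linarith
      have h6 : (driftConst σ ρ Λ + 1) * r + load x - |(x k).1| + |μ| ≤
          potential (driftConst σ ρ Λ) (r + 1) x := by
        unfold potential
        push_cast
        nlinarith [abs_nonneg (x k).1]
      nlinarith [abs_nonneg g]
    calc _ ≤ B * potential (driftConst σ ρ Λ) r (nextState x k (μ + s * g)) := hfb _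
      _ ≤ B * (potential (driftConst σ ρ Λ) (r + 1) x * (1 + |g|)) := by gcongr
      _ = _ := by ring
  have key := hgauss _ _ ((μ' - μ) / s) (s' / s) hfm (mul_nonneg hB hU) hgrowth
  have e : ∀ g, μ + s * ((μ' - μ) / s + s' / s * g) = μ' + s' * g := fun g => by
    field_simp
    ring
  simp only [e] at key
  have hδ : |(μ' - μ) / s| ≤ meanConst ρ Λ / (ℓ * σ) * ε * (1 + |(x k).1|) := by
    rw [abs_div, abs_of_pos hs0]
    calc _ ≤ (meanConst ρ Λ * ε * (1 + |(x k).1|)) / (ℓ * σ) := by gcongr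
      _ = _ := by ring
  have ht : |s' / s - 1| ≤ varConst σ ρ Λ / (ℓ * σ) ^ 2 * ε * (1 + |(x k).1|) := by
    have e1 : s' / s - 1 = (s' ^ 2 - s ^ 2) / (s * (s' + s)) := by
      have : s' + s ≠ 0 := by positivity
      field_simp
      ring
    rw [e1, abs_div, abs_of_pos (by positivity : 0 < s * (s' + s))]
    calc _ ≤ (varConst σ ρ Λ * ε) / (ℓ * σ) ^ 2 := by
          gcongr
          nlinarith
      _ = varConst σ ρ Λ / (ℓ * σ) ^ 2 * ε * 1 := by ring
      _ ≤ _ := by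
          gcongr
          linarith [abs_nonneg (x k).1]
  refine key.trans ?_
  calc _ ≤ C * (B * potential (driftConst σ ρ Λ) (r + 1) x) *
        (meanConst ρ Λ / (ℓ * σ) * ε * (1 + |(x k).1|) +
          varConst σ ρ Λ / (ℓ * σ) ^ 2 * ε * (1 + |(x k).1|)) := by gcongr
    _ = C * B * D * ε * ((1 + |(x k).1|) * potential (driftConst σ ρ Λ) (r + 1) x) := by
        rw [hD]; ring
    _ ≤ _ := by
        gcongr
        linarith

/-- Simulation lemma: one policy earns almost the same in two Markov decision processes with close
parameters. The error terms `(1 + |x k|) * potential` of the single steps are summed up by the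
decrease of the expected squared potential. -/
theorem exists_abs_valueAux_sub_le (σ ρ Λ β ℓ : ℝ) (hσ : 0 < σ) (hρ : ρ < 1) (hΛ : 0 ≤ Λ)
    (hβ : 0 ≤ β) (hℓ : 0 < ℓ) :
    ∃ κ : ℝ, 0 < κ ∧ ∀ (K : ℕ) (M M' : Params K) (ε : ℝ), M.Close M' ρ Λ β ε →
      (∀ k, ℓ ≤ M.lam k) → ∀ π : Policy K, (∀ t, Measurable (π t)) → ∀ r t x,
      |valueAux σ M π r t x - valueAux σ M' π r t x| ≤
        κ * ε * potential (driftConst σ ρ Λ) r x ^ 2 := by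
  have h1ρ : 0 < 1 - ρ := by linarith
  obtain ⟨C, hC, htrans⟩ := exists_abs_integral_transition_sub_le σ ρ Λ ℓ hσ hρ hΛ hℓ
    (valueConst ρ Λ β) (div_nonneg (by positivity) h1ρ.le)
  have hm0 : 0 < meanConst ρ Λ := div_pos (by linarith) h1ρ
  set κ := (meanConst ρ Λ + C) / (1 - ρ) with hκ
  have hκ0 : 0 < κ := by positivity
  refine ⟨κ, hκ0, fun K M M' ε h hlam π hπ r => ?_⟩
  have hc := driftConst_pos hσ hρ hΛ
  induction r with
  | zero =>
    intro t x
    have hε : 0 ≤ ε := (abs_nonneg _).trans (h.γ (π t x))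
    simp only [valueAux, sub_self, abs_zero]
    positivity
  | succ r ih =>
    intro t x
    rw [valueAux_succ, valueAux_succ]
    set k := π t x
    have hε : 0 ≤ ε := (abs_nonneg _).trans (h.γ k)
    have hρ0 : 0 ≤ ρ := (h.left.γ_nonneg k).trans (h.left.γ_le k)
    have hV := measurable_valueAux σ M hπ r (t + 1)
    have hV' := measurable_valueAux σ M' hπ r (t + 1)
    have hVb := abs_valueAux_le h.left hσ hρ hΛ hπ r (t + 1)
    have hVb' := abs_valueAux_le h.right hσ hρ hΛ hπ r (t + 1)
    have h1 := h.abs_reward_sub_le hρ hΛ x k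
    have h2 := htrans K M M' β ε h hlam r _ hV' hVb' x k
    have h3 := (integral_potential_nextState_le h.left hσ hρ hΛ r x k).2
    have hint := (integrable_potential_nextState (driftConst σ ρ Λ) r x k
      (influenceMean M x k) (influenceSd σ M x k)).2
    have h4 : |∫ x', valueAux σ M π r (t + 1) x' ∂(transition σ M x k) -
        ∫ x', valueAux σ M' π r (t + 1) x' ∂(transition σ M x k)| ≤ κ * ε *
        (potential (driftConst σ ρ Λ) (r + 1) x - (1 + (1 - ρ) * |(x k).1|)) ^ 2 := by
      rw [integral_transition σ M x k hV, integral_transition σ M x k hV',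
        ← integral_sub (integrable_of_abs_le_potential hV hVb x k _ _)
          (integrable_of_abs_le_potential hV' hVb' x k _ _)]
      refine abs_integral_le_integral_abs.trans ?_
      refine (integral_mono ((integrable_of_abs_le_potential hV hVb x k _ _).sub
          (integrable_of_abs_le_potential hV' hVb' x k _ _)).abs (hint.const_mul (κ * ε))
          fun g => ih (t + 1) _).trans ?_
      rw [integral_const_mul]
      gcongr
    have hU : 1 + |(x k).1| ≤ potential (driftConst σ ρ Λ) (r + 1) x := by
      have := abs_le_load x k
      have : 0 ≤ (driftConst σ ρ Λ + 1) * r := by positivity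
      unfold potential
      push_cast
      linarith
    set U := potential (driftConst σ ρ Λ) (r + 1) x
    have hy := abs_nonneg (x k).1
    set y := |(x k).1|
    have e : actionValue σ M (valueAux σ M π r (t + 1)) x k -
        actionValue σ M' (valueAux σ M' π r (t + 1)) x k =
        (reward M x k - reward M' x k) +
        (∫ x', valueAux σ M' π r (t + 1) x' ∂(transition σ M x k) -
          ∫ x', valueAux σ M' π r (t + 1) x' ∂(transition σ M' x k)) +
        (∫ x', valueAux σ M π r (t + 1) x' ∂(transition σ M x k) -
          ∫ x', valueAux σ M' π r (t + 1) x' ∂(transition σ M x k)) := by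
      unfold actionValue; ring
    rw [e]
    refine (abs_add_three _ _ _).trans ((add_le_add (add_le_add h1 h2) h4).trans ?_)
    have h5 : meanConst ρ Λ * ε * (1 + y) ≤ meanConst ρ Λ * ε * ((1 + y) * U) := by
      gcongr
      nlinarith
    have h6 : (1 + y) * U ≤ (U ^ 2 - (U - (1 + (1 - ρ) * y)) ^ 2) / (1 - ρ) := by
      rw [le_div_iff₀ h1ρ]
      -- `U² - (U - g)² = g (2 U - g) ≥ g U` for the gain `0 ≤ g ≤ U`
      have hgU : 1 + (1 - ρ) * y ≤ U := by nlinarith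
      have hg : (1 - ρ) * (1 + y) ≤ 1 + (1 - ρ) * y := by nlinarith
      have hg0 : 0 ≤ 1 + (1 - ρ) * y := by positivity
      have hU0 : 0 ≤ U := by linarith
      nlinarith [mul_nonneg hg0 (sub_nonneg.2 hgU), mul_le_mul_of_nonneg_right hg hU0]
    calc _ ≤ meanConst ρ Λ * ε * ((1 + y) * U) + C * ε * ((1 + y) * U) +
          κ * ε * (U - (1 + (1 - ρ) * y)) ^ 2 := by gcongr
      _ = (meanConst ρ Λ + C) * ε * ((1 + y) * U) + κ * ε * (U - (1 + (1 - ρ) * y)) ^ 2 := by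
          ring
      _ ≤ (meanConst ρ Λ + C) * ε * ((U ^ 2 - (U - (1 + (1 - ρ) * y)) ^ 2) / (1 - ρ)) +
          κ * ε * (U - (1 + (1 - ρ) * y)) ^ 2 := by gcongr
      _ = _ := by rw [hκ]; field_simp; ring

end Compare

/-- A policy that is optimal for close parameters is nearly optimal. -/
theorem exists_abs_value_sub_value_le (σ ρ Λ β ℓ : ℝ) (hσ : 0 < σ) (hρ : ρ < 1) (hΛ : 0 ≤ Λ)
    (hβ : 0 ≤ β) (hℓ : 0 < ℓ) :
    ∃ κ : ℝ, 0 < κ ∧ ∀ (K : ℕ) (M M' : Params K) (ε : ℝ), M.Close M' ρ Λ β ε →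
      (∀ k, ℓ ≤ M.lam k) → ∀ (T : ℕ) (π π' : Policy K), IsOptimal σ M T π →
      IsOptimal σ M' T π' →
      |value σ M T π 1 (initState K) - value σ M T π' 1 (initState K)| ≤
        κ * ε * (T : ℝ) ^ 2 := by
  obtain ⟨κ, hκ, hsim⟩ := exists_abs_valueAux_sub_le σ ρ Λ β ℓ hσ hρ hΛ hβ hℓ
  have hc := driftConst_pos hσ hρ hΛ
  refine ⟨2 * κ * (driftConst σ ρ Λ + 1) ^ 2, by positivity,
    fun K M M' ε h hlam T π π' hπ hπ' => ?_⟩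
  have h1 := hsim K M M' ε h hlam π hπ.1 T 1 (initState K)
  have h2 := hsim K M M' ε h hlam π' hπ'.1 T 1 (initState K)
  have h3 := hπ.2 π' hπ'.1
  have h4 := hπ'.2 π hπ.1
  simp only [value, Nat.add_sub_cancel] at h3 h4 ⊢
  simp only [potential, load_initState, add_zero] at h1 h2
  rw [abs_of_nonneg (sub_nonneg.2 h3)]
  have h5 := (abs_le.1 h1).2
  have h6 := (abs_le.1 h2).1
  have e : 2 * κ * (driftConst σ ρ Λ + 1) ^ 2 * ε * (T : ℝ) ^ 2 =
      2 * (κ * ε * ((driftConst σ ρ Λ + 1) * T) ^ 2) := by ring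
  rw [e]
  linarith

end MDP

/-! ### Noise of the data -/

section Orthogonal

variable {Ω : Type*} [MeasurableSpace Ω] {P : Measure Ω}

lemma integral_sq_sum_le_of_orthogonal {ι : Type*} (s : Finset ι) {X : ι → Ω → ℝ} {B : ℝ}
    (hX : ∀ i ∈ s, MemLp (X i) 2 P)
    (horth : ∀ i ∈ s, ∀ j ∈ s, i ≠ j → ∫ ω, X i ω * X j ω ∂P = 0)
    (hB : ∀ i ∈ s, ∫ ω, X i ω ^ 2 ∂P ≤ B) :
    ∫ ω, (∑ i ∈ s, X i ω) ^ 2 ∂P ≤ s.card * B := by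
  have hint : ∀ i ∈ s, ∀ j ∈ s, Integrable (fun ω => X i ω * X j ω) P := fun i hi j hj =>
    (hX i hi).integrable_mul (hX j hj)
  have e : ∀ ω, (∑ i ∈ s, X i ω) ^ 2 = ∑ i ∈ s, ∑ j ∈ s, X i ω * X j ω := fun ω => by
    rw [sq, Finset.sum_mul_sum]
  simp only [e]
  rw [integral_finsetSum _ fun i hi => integrable_finsetSum _ (hint i hi)]
  calc ∑ i ∈ s, ∫ ω, ∑ j ∈ s, X i ω * X j ω ∂P = ∑ i ∈ s, ∫ ω, X i ω ^ 2 ∂P := by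
        refine Finset.sum_congr rfl fun i hi => ?_
        rw [integral_finsetSum _ (hint i hi), Finset.sum_eq_single_of_mem i hi fun j hj hne =>
          horth i hi j hj hne.symm]
        simp only [sq]
    _ ≤ ∑ _i ∈ s, B := Finset.sum_le_sum hB
    _ = _ := by simp

/-- Chebyshev's inequality for sums of centered orthogonal random variables. -/
lemma measure_le_abs_sum_le_of_orthogonal [IsProbabilityMeasure P] {ι : Type*} (s : Finset ι)
    {X : ι → Ω → ℝ} {B c : ℝ} (hc : 0 < c) {n : ℕ} (hn : 1 ≤ n) (hs : s.card ≤ n) (hB0 : 0 ≤ B)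
    (hX : ∀ i ∈ s, MemLp (X i) 2 P)
    (horth : ∀ i ∈ s, ∀ j ∈ s, i ≠ j → ∫ ω, X i ω * X j ω ∂P = 0)
    (hB : ∀ i ∈ s, ∫ ω, X i ω ^ 2 ∂P ≤ B) :
    P {ω | c * √n ≤ |∑ i ∈ s, X i ω|} ≤ ENNReal.ofReal (B / c ^ 2) := by
  have hn0 : (0 : ℝ) < n := by exact_mod_cast hn
  have hL : MemLp (fun ω => ∑ i ∈ s, X i ω) 2 P := memLp_finsetSum s hX
  have h1 := mul_meas_ge_le_integral_of_nonneg
    (ae_of_all P fun ω => sq_nonneg (∑ i ∈ s, X i ω)) hL.integrable_sq (c ^ 2 * n)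
  have h2 := integral_sq_sum_le_of_orthogonal s hX horth hB
  have h3 : {ω | c * √n ≤ |∑ i ∈ s, X i ω|} ⊆ {ω | c ^ 2 * n ≤ (∑ i ∈ s, X i ω) ^ 2} := by
    intro ω hω
    have : (c * √n) ^ 2 ≤ |∑ i ∈ s, X i ω| ^ 2 := pow_le_pow_left₀ (by positivity) hω 2
    rwa [sq_abs, mul_pow, Real.sq_sqrt hn0.le] at this
  refine (measure_mono h3).trans ?_
  rw [← ofReal_measureReal]
  apply ENNReal.ofReal_le_ofReal
  have h4 : (s.card : ℝ) * B ≤ n * B := by gcongr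
  rw [le_div_iff₀ (by positivity)]
  have h5 : n * (P.real {ω | c ^ 2 * n ≤ (∑ i ∈ s, X i ω) ^ 2} * c ^ 2) ≤ n * B := by
    calc _ = c ^ 2 * n * P.real {ω | c ^ 2 * n ≤ (∑ i ∈ s, X i ω) ^ 2} := by ring
      _ ≤ _ := h1.trans (h2.trans h4)
  exact le_of_mul_le_mul_left h5 hn0

end Orthogonal

section Noise

variable {Ω : Type*} {v : NNReal} {n N : ℕ} {z : ℕ → ℕ → Ω → ℝ} {a : ℝ}

/-- The σ-algebra generated by the noise variables with indices in `S`. -/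
abbrev noiseSigma (n N : ℕ) (z : ℕ → ℕ → Ω → ℝ) (S : Set (ℕ × ℕ)) : MeasurableSpace Ω :=
  ⨆ p : ↥(Finset.Icc 1 n ×ˢ Finset.Icc 1 N), ⨆ _ : p ∈ (Subtype.val ⁻¹' S : Set _),
    MeasurableSpace.comap (z p.1.1 p.1.2) inferInstance

lemma measurable_noise {S : Set (ℕ × ℕ)} {i j : ℕ} (hi : i ∈ Finset.Icc 1 n)
    (hj : j ∈ Finset.Icc 1 N) (hS : (i, j) ∈ S) : Measurable[noiseSigma n N z S] (z i j) := by
  rw [measurable_iff_comap_le]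
  exact le_iSup₂_of_le (⟨(i, j), Finset.mk_mem_product hi hj⟩ :
    ↥(Finset.Icc 1 n ×ˢ Finset.Icc 1 N)) hS le_rfl

/-- The centered trajectory: `walk a z i j` is the deviation of the `(j + 1)`-st observation of
trajectory `i` from its mean. -/
def walk (a : ℝ) (z : ℕ → ℕ → Ω → ℝ) (i : ℕ) : ℕ → Ω → ℝ
  | 0 => fun _ => 0
  | j + 1 => fun ω => a * walk a z i j ω + z i (j + 1) ω

/-- The variance of `walk a z i j` for noise of variance `v`. -/
def walkVar (a : ℝ) (v : NNReal) : ℕ → NNReal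
  | 0 => 0
  | j + 1 => .mk (a ^ 2) (sq_nonneg a) * walkVar a v j + v

lemma walkVar_pos (hv : 0 < v) {j : ℕ} (hj : 1 ≤ j) : 0 < walkVar a v j := by
  obtain ⟨j, rfl⟩ := Nat.exists_eq_add_of_le' hj
  exact add_pos_of_nonneg_of_pos zero_le hv

lemma measurable_walk {S : Set (ℕ × ℕ)} {i : ℕ} (hi : i ∈ Finset.Icc 1 n) :
    ∀ j ≤ N, (∀ l ∈ Finset.Icc 1 j, (i, l) ∈ S) → Measurable[noiseSigma n N z S] (walk a z i j)
  | 0, _, _ => measurable_const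
  | j + 1, hj, hS => by
      have h1 := measurable_walk hi j (by omega) fun l hl => hS l (by simp at hl ⊢; omega)
      exact (h1.const_mul a).add
        (measurable_noise hi (by simp; omega) (hS (j + 1) (by simp)))

/-- The difference of the centered trajectories `i` and `2 * i`. The differences for distinct `i`
are in general dependent. -/
def walkDiff (a : ℝ) (z : ℕ → ℕ → Ω → ℝ) (N i : ℕ) : Ω → ℝ :=
  fun ω => walk a z i N ω - walk a z (2 * i) N ω

lemma measurable_walkDiff {S : Set (ℕ × ℕ)} {i : ℕ} (hi : i ∈ Finset.Icc 1 (n / 2)) {j : ℕ}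
    (hj : j ≤ N) (hS : ∀ l ∈ Finset.Icc 1 j, (i, l) ∈ S ∧ (2 * i, l) ∈ S) :
    Measurable[noiseSigma n N z S] (walkDiff a z j i) :=
  (measurable_walk (by simp at hi ⊢; omega) j hj fun l hl => (hS l hl).1).sub
    (measurable_walk (by simp at hi ⊢; omega) j hj fun l hl => (hS l hl).2)

variable [MeasurableSpace Ω] {P : Measure Ω}

/-- `z i j`, for `1 ≤ i ≤ n` and `1 ≤ j ≤ N`, are independent centered Gaussian variables with
variance `v`. -/
structure GaussianNoise (P : Measure Ω) (v : NNReal) (n N : ℕ) (z : ℕ → ℕ → Ω → ℝ) : Prop where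
  measurable : ∀ i j, Measurable (z i j)
  law : ∀ i ∈ Finset.Icc 1 n, ∀ j ∈ Finset.Icc 1 N, P.map (z i j) = gaussianReal 0 v
  indep : iIndepFun (fun p : ↥(Finset.Icc 1 n ×ˢ Finset.Icc 1 N) => z p.1.1 p.1.2) P

lemma GaussianNoise.noiseSigma_le (hz : GaussianNoise P v n N z) (S : Set (ℕ × ℕ)) :
    noiseSigma n N z S ≤ ‹MeasurableSpace Ω› :=
  iSup₂_le fun _ _ => (hz.measurable _ _).comap_le

lemma GaussianNoise.indepFun (hz : GaussianNoise P v n N z) {S S' : Set (ℕ × ℕ)}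
    (hS : Disjoint S S') {f g : Ω → ℝ} (hf : Measurable[noiseSigma n N z S] f)
    (hg : Measurable[noiseSigma n N z S'] g) : IndepFun f g P := by
  rw [IndepFun_iff_Indep]
  have h := indep_iSup_of_disjoint (fun p => (hz.measurable _ _).comap_le)
    ((iIndepFun_iff_iIndep _ _ _).1 hz.indep)
    (hS.preimage (Subtype.val : ↥(Finset.Icc 1 n ×ˢ Finset.Icc 1 N) → ℕ × ℕ))
  exact indep_of_indep_of_le_left (indep_of_indep_of_le_right h hg.comap_le) hf.comap_le

lemma GaussianNoise.map_walk [IsProbabilityMeasure P] (hz : GaussianNoise P v n N z) {i : ℕ}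
    (hi : i ∈ Finset.Icc 1 n) :
    ∀ j ≤ N, P.map (walk a z i j) = gaussianReal 0 (walkVar a v j)
  | 0, _ => by
      simp [walk, walkVar, Measure.map_const]
  | j + 1, hj => by
      have hjN : j + 1 ∈ Finset.Icc 1 N := by simp; omega
      have hm : Measurable[noiseSigma n N z {p | p.2 ≤ j}] (walk a z i j) :=
        measurable_walk hi j (by omega) fun l hl => (Finset.mem_Icc.1 hl).2
      have hm' := hm.mono (hz.noiseSigma_le _) le_rfl
      have hind : IndepFun (fun ω => a * walk a z i j ω) (z i (j + 1)) P :=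
        hz.indepFun (S := {p | p.2 ≤ j}) (S' := {(i, j + 1)}) (by simp) (hm.const_mul a)
          (measurable_noise hi hjN (Set.mem_singleton _))
      have h1 : P.map (fun ω => a * walk a z i j ω) =
          gaussianReal 0 (.mk (a ^ 2) (sq_nonneg a) * walkVar a v j) := by
        have h2 := gaussianReal_map_const_mul (μ := 0) (v := walkVar a v j) a
        rw [← hz.map_walk hi j (by omega), Measure.map_map (by fun_prop) hm', mul_zero] at h2
        exact h2
      have h3 := gaussianReal_add_gaussianReal_of_indepFun hind h1 (hz.law i hi _ hjN)
      rw [add_zero] at h3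
      exact h3

lemma GaussianNoise.map_walkDiff [IsProbabilityMeasure P] (hz : GaussianNoise P v n N z) {i j : ℕ}
    (hi : i ∈ Finset.Icc 1 (n / 2)) (hj : j ≤ N) :
    P.map (walkDiff a z j i) = gaussianReal 0 (walkVar a v j + walkVar a v j) := by
  have hi1 : i ∈ Finset.Icc 1 n := by simp at hi ⊢; omega
  have hi2 : 2 * i ∈ Finset.Icc 1 n := by simp at hi ⊢; omega
  have hm1 : Measurable[noiseSigma n N z {p | p.1 = i}] (walk a z i j) :=
    measurable_walk hi1 j hj fun _ _ => rfl
  have hm2 : Measurable[noiseSigma n N z {p | p.1 = 2 * i}] (walk a z (2 * i) j) :=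
    measurable_walk hi2 j hj fun _ _ => rfl
  have hind : IndepFun (walk a z i j) (fun ω => -walk a z (2 * i) j ω) P := by
    refine hz.indepFun ?_ hm1 hm2.neg
    rw [Set.disjoint_left]
    rintro ⟨p, q⟩ h1 h2
    simp only [Set.mem_ofPred_eq, Finset.mem_Icc] at h1 h2 hi
    omega
  have h1 : P.map (fun ω => -walk a z (2 * i) j ω) = gaussianReal 0 (walkVar a v j) := by
    have h2 := gaussianReal_map_neg (μ := 0) (v := walkVar a v j)
    rw [← hz.map_walk hi2 j hj, Measure.map_map (by fun_prop)
      (hm2.mono (hz.noiseSigma_le _) le_rfl), neg_zero] at h2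
    exact h2
  have h3 := gaussianReal_add_gaussianReal_of_indepFun hind (hz.map_walk hi1 j hj) h1
  rw [add_zero] at h3
  rw [← h3]
  congr 1

lemma memLp_of_map_eq_gaussianReal {f : Ω → ℝ} (hf : Measurable f) {w : NNReal}
    (h : P.map f = gaussianReal 0 w) : MemLp f 2 P := by
  have := memLp_id_gaussianReal' (μ := 0) (v := w) 2 (by simp)
  rw [← h, memLp_map_measure_iff (by fun_prop) hf.aemeasurable] at this
  exact this

lemma integral_of_map_eq_gaussianReal {f : Ω → ℝ} (hf : Measurable f) {w : NNReal}
    (h : P.map f = gaussianReal 0 w) : ∫ ω, f ω ∂P = 0 := by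
  have := integral_id_gaussianReal (μ := 0) (v := w)
  rwa [← h, integral_map hf.aemeasurable (by fun_prop)] at this

lemma integral_sq_of_map_eq_gaussianReal {f : Ω → ℝ} (hf : Measurable f) {w : NNReal}
    (h : P.map f = gaussianReal 0 w) : ∫ ω, f ω ^ 2 ∂P = w := by
  have h1 := variance_fun_id_gaussianReal (μ := 0) (v := w)
  rw [variance_eq_integral (by fun_prop), integral_id_gaussianReal, ← h,
    integral_map hf.aemeasurable (by fun_prop)] at h1
  simpa using h1

/-- The sums of products in the least squares numerator. Although the differences of trajectories
are dependent, the products are orthogonal: each fresh noise variable is independent of all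
the other factors. -/
lemma GaussianNoise.measure_sum_walkDiff_mul_le [IsProbabilityMeasure P]
    (hz : GaussianNoise P v n (N + 1) z) (hn : 1 ≤ n) {φ : ℕ → ℕ} (hφ : Function.Injective φ)
    (hφn : ∀ i ∈ Finset.Icc 1 (n / 2), φ i ∈ Finset.Icc 1 n) {c : ℝ} (hc : 0 < c) :
    P {ω | c * √n ≤ |∑ i ∈ Finset.Icc 1 (n / 2), walkDiff a z N i ω * z (φ i) (N + 1) ω|} ≤
      ENNReal.ofReal (((walkVar a v N + walkVar a v N : NNReal) * v : ℝ) / c ^ 2) := by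
  have hN : N + 1 ∈ Finset.Icc 1 (N + 1) := by simp
  have hY : ∀ i ∈ Finset.Icc 1 (n / 2), ∀ S : Set (ℕ × ℕ), (∀ p : ℕ × ℕ, p.2 ≤ N → p ∈ S) →
      Measurable[noiseSigma n (N + 1) z S] (walkDiff a z N i) := fun i hi S hS =>
    measurable_walkDiff hi (by omega) fun l hl =>
      ⟨hS _ (Finset.mem_Icc.1 hl).2, hS _ (Finset.mem_Icc.1 hl).2⟩
  have hYm : ∀ i ∈ Finset.Icc 1 (n / 2), Measurable (walkDiff a z N i) := fun i hi =>
    (hY i hi Set.univ fun _ _ => trivial).mono (hz.noiseSigma_le _) le_rfl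
  have hYl := fun i (hi : i ∈ Finset.Icc 1 (n / 2)) =>
    hz.map_walkDiff (a := a) hi (by omega : N ≤ N + 1)
  have hzl := fun i (hi : i ∈ Finset.Icc 1 (n / 2)) => hz.law (φ i) (hφn i hi) _ hN
  have hind : ∀ i ∈ Finset.Icc 1 (n / 2),
      IndepFun (fun ω => walkDiff a z N i ω ^ 2) (fun ω => z (φ i) (N + 1) ω ^ 2) P := by
    intro i hi
    refine hz.indepFun (S := {p | p.2 ≤ N}) (S' := {(φ i, N + 1)}) (by simp)
      ((hY i hi _ fun _ h => h).pow_const 2)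
      ((measurable_noise (hφn i hi) hN (Set.mem_singleton _)).pow_const 2)
  have hX : ∀ i ∈ Finset.Icc 1 (n / 2),
      MemLp (fun ω => walkDiff a z N i ω * z (φ i) (N + 1) ω) 2 P := by
    intro i hi
    have hm : Measurable fun ω => walkDiff a z N i ω * z (φ i) (N + 1) ω :=
      (hYm i hi).mul (hz.measurable _ _)
    rw [memLp_two_iff_integrable_sq hm.aestronglyMeasurable]
    simp only [mul_pow]
    exact (hind i hi).integrable_mul
      (memLp_of_map_eq_gaussianReal (hYm i hi) (hYl i hi)).integrable_sq
      (memLp_of_map_eq_gaussianReal (hz.measurable _ _) (hzl i hi)).integrable_sq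
  refine measure_le_abs_sum_le_of_orthogonal _ hc hn (by simp; omega) (by positivity) hX ?_ ?_
  · intro i hi j hj hne
    have e : ∀ ω, walkDiff a z N i ω * z (φ i) (N + 1) ω *
        (walkDiff a z N j ω * z (φ j) (N + 1) ω) =
        z (φ i) (N + 1) ω * (walkDiff a z N i ω * (walkDiff a z N j ω * z (φ j) (N + 1) ω)) :=
      fun ω => by ring
    have hS : ∀ p : ℕ × ℕ, p.2 ≤ N → p ∈ ({(φ i, N + 1)}ᶜ : Set (ℕ × ℕ)) := by
      rintro ⟨p, q⟩ hp h
      simp only [Set.mem_singleton_iff, Prod.mk.injEq] at h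
      simp only at hp
      omega
    have hne' : (φ j, N + 1) ∈ ({(φ i, N + 1)}ᶜ : Set (ℕ × ℕ)) := by
      simpa using fun h => hne (hφ h).symm
    have hi' : IndepFun (z (φ i) (N + 1))
        (fun ω => walkDiff a z N i ω * (walkDiff a z N j ω * z (φ j) (N + 1) ω)) P :=
      hz.indepFun (S := {(φ i, N + 1)}) disjoint_compl_right
        (measurable_noise (hφn i hi) hN (Set.mem_singleton _))
        ((hY i hi _ hS).mul ((hY j hj _ hS).mul (measurable_noise (hφn j hj) hN hne')))
    simp only [e]
    rw [hi'.integral_fun_mul_eq_mul_integral (hz.measurable _ _).aestronglyMeasurable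
      ((hYm i hi).mul ((hYm j hj).mul (hz.measurable _ _))).aestronglyMeasurable,
      integral_of_map_eq_gaussianReal (hz.measurable _ _) (hzl i hi), zero_mul]
  · intro i hi
    simp only [mul_pow]
    rw [(hind i hi).integral_fun_mul_eq_mul_integral ((hYm i hi).pow_const 2).aestronglyMeasurable
      ((hz.measurable _ _).pow_const 2).aestronglyMeasurable,
      integral_sq_of_map_eq_gaussianReal (hYm i hi) (hYl i hi),
      integral_sq_of_map_eq_gaussianReal (hz.measurable _ _) (hzl i hi)]

lemma GaussianNoise.measure_sum_le [IsProbabilityMeasure P]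
    (hz : GaussianNoise P v n (N + 1) z) (hn : 1 ≤ n) {c : ℝ} (hc : 0 < c) :
    P {ω | c * √n ≤ |∑ i ∈ Finset.Icc 1 n, z i 1 ω|} ≤ ENNReal.ofReal ((v : ℝ) / c ^ 2) := by
  have h1 : 1 ∈ Finset.Icc 1 (N + 1) := by simp
  refine measure_le_abs_sum_le_of_orthogonal _ hc hn (by simp) (by positivity)
    (fun i hi => memLp_of_map_eq_gaussianReal (hz.measurable _ _) (hz.law i hi 1 h1)) ?_
    fun i hi => (integral_sq_of_map_eq_gaussianReal (hz.measurable _ _) (hz.law i hi 1 h1)).le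
  intro i hi j hj hne
  have hind : IndepFun (z i 1) (z j 1) P :=
    hz.indepFun (S := {(i, 1)}) (S' := {(j, 1)}) (by simpa using hne)
      (measurable_noise hi h1 (Set.mem_singleton _))
      (measurable_noise hj h1 (Set.mem_singleton _))
  rw [hind.integral_fun_mul_eq_mul_integral (hz.measurable _ _).aestronglyMeasurable
    (hz.measurable _ _).aestronglyMeasurable,
    integral_of_map_eq_gaussianReal (hz.measurable _ _) (hz.law i hi 1 h1), zero_mul]

/-- The mean of `min (Y ^ 2) 1` for a centered Gaussian variable `Y` of variance `w`. Truncation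
keeps the second moments of the summands in the denominator bounded. -/
def truncMean (w : NNReal) : ℝ := ∫ y, min (y ^ 2) 1 ∂(gaussianReal 0 w)

lemma integrable_min_sq {μ : Measure ℝ} [IsFiniteMeasure μ] :
    Integrable (fun y : ℝ => min (y ^ 2) 1) μ := by
  refine (integrable_const (1 : ℝ)).mono' (by fun_prop) (ae_of_all _ fun y => ?_)
  rw [Real.norm_of_nonneg (by positivity)]
  exact min_le_right _ _

lemma truncMean_pos {w : NNReal} (hw : 0 < w) : 0 < truncMean w := by
  unfold truncMean
  rw [integral_pos_iff_support_of_nonneg (fun y => by positivity) integrable_min_sq]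
  have : NullSingletonClass (gaussianReal 0 w) := nullSingletonClass_gaussianReal hw.ne'
  have h : (Function.support fun y : ℝ => min (y ^ 2) 1) = {0}ᶜ := by
    ext y
    simp only [Function.mem_support, Set.mem_compl_iff, Set.mem_singleton_iff, not_iff_not]
    constructor
    · intro h
      rcases min_choice (y ^ 2) 1 with h' | h' <;> rw [h'] at h
      · exact pow_eq_zero_iff two_ne_zero |>.1 h
      · norm_num at h
    · rintro rfl
      simp
  rw [h, prob_compl_eq_one_sub (measurableSet_singleton _), measure_singleton]
  simp

lemma truncMean_mem (w : NNReal) : 0 ≤ truncMean w ∧ truncMean w ≤ 1 := by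
  refine ⟨integral_nonneg fun y => by positivity, ?_⟩
  calc truncMean w ≤ ∫ _, (1 : ℝ) ∂(gaussianReal 0 w) :=
        integral_mono integrable_min_sq (integrable_const _) fun y => min_le_right _ _
    _ = 1 := by simp

/-- The least squares denominator. For `n / 4 < i ≤ n / 2` the pairs of trajectories `i`, `2 * i`
are disjoint, so that the corresponding differences are independent. -/
lemma GaussianNoise.measure_sum_trunc_le [IsProbabilityMeasure P]
    (hz : GaussianNoise P v n (N + 1) z) (hn : 1 ≤ n) {c : ℝ} (hc : 0 < c) :
    P {ω | c * √n ≤ |∑ i ∈ Finset.Ioc (n / 4) (n / 2), (min (walkDiff a z N i ω ^ 2) 1 -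
      truncMean (walkVar a v N + walkVar a v N))|} ≤ ENNReal.ofReal (1 / c ^ 2) := by
  set p := truncMean (walkVar a v N + walkVar a v N) with hp
  have hp01 := truncMean_mem (walkVar a v N + walkVar a v N)
  have hs : ∀ i ∈ Finset.Ioc (n / 4) (n / 2), i ∈ Finset.Icc 1 (n / 2) := by
    intro i hi
    simp at hi ⊢
    omega
  have hY : ∀ i ∈ Finset.Ioc (n / 4) (n / 2),
      Measurable[noiseSigma n (N + 1) z {q | q.1 = i ∨ q.1 = 2 * i}]
        fun ω => min (walkDiff a z N i ω ^ 2) 1 - p := fun i hi =>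
    (((measurable_walkDiff (hs i hi) (by omega) fun l _ =>
      ⟨Or.inl rfl, Or.inr rfl⟩).pow_const 2).min measurable_const).sub measurable_const
  have hYm := fun i hi => (hY i hi).mono (hz.noiseSigma_le _) le_rfl
  have hb : ∀ i ω, |min (walkDiff a z N i ω ^ 2) 1 - p| ≤ 1 := by
    intro i ω
    have h1 : min (walkDiff a z N i ω ^ 2) 1 ≤ 1 := min_le_right _ _
    have h2 : 0 ≤ min (walkDiff a z N i ω ^ 2) 1 := by positivity
    rw [abs_le]
    constructor <;> linarith
  have hmean : ∀ i ∈ Finset.Ioc (n / 4) (n / 2),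
      ∫ ω, (min (walkDiff a z N i ω ^ 2) 1 - p) ∂P = 0 := by
    intro i hi
    have hm : Measurable (walkDiff a z N i) :=
      (measurable_walkDiff (S := Set.univ) (hs i hi) (by omega : N ≤ N + 1)
        fun l _ => ⟨trivial, trivial⟩).mono (hz.noiseSigma_le _) le_rfl
    rw [← integral_map (f := fun y : ℝ => min (y ^ 2) 1 - p) hm.aemeasurable (by fun_prop),
      hz.map_walkDiff (hs i hi) (by omega), integral_sub integrable_min_sq (integrable_const _)]
    simp [hp, truncMean]
  refine measure_le_abs_sum_le_of_orthogonal _ hc hn (by simp; omega) zero_le_one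
    (fun i hi => MemLp.of_bound (hYm i hi).aestronglyMeasurable 1 (ae_of_all _ fun ω => hb i ω))
    ?_ ?_
  · intro i hi j hj hne
    have hind : IndepFun (fun ω => min (walkDiff a z N i ω ^ 2) 1 - p)
        (fun ω => min (walkDiff a z N j ω ^ 2) 1 - p) P := by
      refine hz.indepFun ?_ (hY i hi) (hY j hj)
      rw [Set.disjoint_left]
      rintro ⟨q, q'⟩ h1 h2
      simp only [Set.mem_ofPred_eq, Finset.mem_Ioc] at h1 h2 hi hj
      omega
    rw [hind.integral_fun_mul_eq_mul_integral (hYm i hi).aestronglyMeasurable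
      (hYm j hj).aestronglyMeasurable, hmean i hi, zero_mul]
  · intro i hi
    calc ∫ ω, (min (walkDiff a z N i ω ^ 2) 1 - p) ^ 2 ∂P ≤ ∫ _, (1 : ℝ) ∂P := by
          refine integral_mono_of_nonneg (ae_of_all _ fun ω => sq_nonneg _) (integrable_const _)
            (ae_of_all _ fun ω => ?_)
          have := hb i ω
          exact (sq_le_one_iff_abs_le_one _).2 this
      _ = 1 := by simp

end Noise

/-! ### Estimation errors -/

section Estimation

variable {Ω : Type*}

/-- The expectation of the `(j + 1)`-st observation of a trajectory. -/
def trajMean (a d : ℝ) : ℕ → ℝ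
  | 0 => 0
  | j + 1 => a * trajMean a d j + d

lemma trajectory_eq {a d : ℝ} {n N : ℕ} {x z : ℕ → ℕ → Ω → ℝ} {ω : Ω}
    (h1 : ∀ i ∈ Finset.Icc 1 n, x i 1 ω = 0)
    (hx : ∀ i ∈ Finset.Icc 1 n, ∀ j ∈ Finset.Icc 1 N, x i (j + 1) ω = a * x i j ω + d + z i j ω)
    {i : ℕ} (hi : i ∈ Finset.Icc 1 n) :
    ∀ j ≤ N, x i (j + 1) ω = trajMean a d j + walk a z i j ω
  | 0, _ => by simp [h1 i hi, trajMean, walk]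
  | j + 1, hj => by
      rw [hx i hi (j + 1) (by simp; omega), trajectory_eq h1 hx hi j (by omega), trajMean, walk]
      ring

/-- The error of the least squares estimate in terms of the noise. -/
lemma aHat_eq {a d : ℝ} {n N : ℕ} {x z : ℕ → ℕ → Ω → ℝ} {ω : Ω}
    (h1 : ∀ i ∈ Finset.Icc 1 n, x i 1 ω = 0)
    (hx : ∀ i ∈ Finset.Icc 1 n, ∀ j ∈ Finset.Icc 1 (N + 1),
      x i (j + 1) ω = a * x i j ω + d + z i j ω) :
    aHat n (N + 1) (fun i j => x i j ω) =
      (a * ∑ i ∈ Finset.Icc 1 (n / 2), walkDiff a z N i ω ^ 2 +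
        (∑ i ∈ Finset.Icc 1 (n / 2), walkDiff a z N i ω * z i (N + 1) ω -
          ∑ i ∈ Finset.Icc 1 (n / 2), walkDiff a z N i ω * z (2 * i) (N + 1) ω)) /
      ∑ i ∈ Finset.Icc 1 (n / 2), walkDiff a z N i ω ^ 2 := by
  have hd : ∀ i ∈ Finset.Icc 1 (n / 2), ∀ j ≤ N + 1,
      x i (j + 1) ω - x (2 * i) (j + 1) ω = walkDiff a z j i ω := by
    intro i hi j hj
    rw [trajectory_eq h1 hx (by simp at hi ⊢; omega) j hj,
      trajectory_eq h1 hx (by simp at hi ⊢; omega) j hj, walkDiff]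
    ring
  unfold aHat
  congr 1
  · rw [Finset.mul_sum, ← Finset.sum_sub_distrib, ← Finset.sum_add_distrib]
    refine Finset.sum_congr rfl fun i hi => ?_
    rw [hd i hi N (by omega), hd i hi (N + 1) le_rfl]
    simp only [walkDiff, walk]
    ring
  · exact Finset.sum_congr rfl fun i hi => by rw [hd i hi N (by omega)]

lemma dHat_sub_eq {a d : ℝ} {n N : ℕ} {x z : ℕ → ℕ → Ω → ℝ} {ω : Ω} (hn : 1 ≤ n)
    (h1 : ∀ i ∈ Finset.Icc 1 n, x i 1 ω = 0)
    (hx : ∀ i ∈ Finset.Icc 1 n, ∀ j ∈ Finset.Icc 1 (N + 1),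
      x i (j + 1) ω = a * x i j ω + d + z i j ω) :
    dHat n (fun i j => x i j ω) - d = (∑ i ∈ Finset.Icc 1 n, z i 1 ω) / n := by
  have hn0 : (n : ℝ) ≠ 0 := by exact_mod_cast (by omega : n ≠ 0)
  have e : ∑ i ∈ Finset.Icc 1 n, x i 2 ω = n * d + ∑ i ∈ Finset.Icc 1 n, z i 1 ω := by
    rw [Finset.sum_congr rfl fun i hi => (hx i hi 1 (by simp)).trans (by rw [h1 i hi])]
    simp [Finset.sum_add_distrib]
  unfold dHat
  rw [e]
  field_simp
  ring

lemma walk_eq_zero {a : ℝ} {z : ℕ → ℕ → Ω → ℝ} {i : ℕ} {ω : Ω} :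
    ∀ N, (∀ j ∈ Finset.Icc 1 N, z i j ω = 0) → walk a z i N ω = 0
  | 0, _ => rfl
  | j + 1, h => by
      change a * walk a z i j ω + z i (j + 1) ω = 0
      rw [walk_eq_zero j fun l hl => h l (by simp at hl ⊢; omega), h (j + 1) (by simp)]
      simp

/-- If all noise sums are of order `√n`, so is `n` times the error of the least squares
estimate. -/
lemma abs_aHat_sub_le {a d p c : ℝ} {n N : ℕ} {x z : ℕ → ℕ → Ω → ℝ} {ω : Ω} (hn : 1 ≤ n)
    (ha0 : 0 ≤ a) (ha1 : a ≤ 1) (hp : 0 < p) (hc : 0 < c)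
    (h1 : ∀ i ∈ Finset.Icc 1 n, x i 1 ω = 0)
    (hx : ∀ i ∈ Finset.Icc 1 n, ∀ j ∈ Finset.Icc 1 (N + 1),
      x i (j + 1) ω = a * x i j ω + d + z i j ω)
    (hS1 : |∑ i ∈ Finset.Icc 1 (n / 2), walkDiff a z N i ω * z i (N + 1) ω| < c * √n)
    (hS2 : |∑ i ∈ Finset.Icc 1 (n / 2), walkDiff a z N i ω * z (2 * i) (N + 1) ω| < c * √n)
    (hS3 : |∑ i ∈ Finset.Ioc (n / 4) (n / 2), (min (walkDiff a z N i ω ^ 2) 1 - p)| < c * √n)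
    (hI : aHat n (N + 1) (fun i j => x i j ω) ∈ Set.Ioo 0 1) :
    |aHat n (N + 1) (fun i j => x i j ω) - a| ≤ (48 * c / p + 2) / √n := by
  have hn0 : (0 : ℝ) < n := by exact_mod_cast hn
  have hsn : 0 < √(n : ℝ) := Real.sqrt_pos.2 hn0
  have hsq : √(n : ℝ) * √n = n := Real.mul_self_sqrt hn0.le
  have hcp : 0 < c / p := by positivity
  rw [le_div_iff₀ hsn]
  -- For small `n` it is enough that both numbers lie in `[0, 1]`; for large `n` the denominator is
  -- at least `p n / 16`.
  rcases lt_or_ge (√(n : ℝ)) (16 * c / p + 2) with hsmall | hlarge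
  · have h : |aHat n (N + 1) (fun i j => x i j ω) - a| ≤ 1 := by
      rw [abs_le]
      constructor <;> linarith [hI.1, hI.2]
    have e1 : 16 * c / p = 16 * (c / p) := by ring
    have e2 : 48 * c / p = 48 * (c / p) := by ring
    rw [e1] at hsmall
    rw [e2]
    nlinarith
  · rw [aHat_eq h1 hx]
    set D := ∑ i ∈ Finset.Icc 1 (n / 2), walkDiff a z N i ω ^ 2
    set S1 := ∑ i ∈ Finset.Icc 1 (n / 2), walkDiff a z N i ω * z i (N + 1) ω
    set S2 := ∑ i ∈ Finset.Icc 1 (n / 2), walkDiff a z N i ω * z (2 * i) (N + 1) ω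
    have hcs : c * √n ≤ p * n / 16 := by
      have h16 : 16 * c / p ≤ √n := by linarith
      rw [div_le_iff₀ hp] at h16
      nlinarith
    have hn4 : 4 ≤ n := by
      have : (4 : ℝ) ≤ n := by nlinarith [(by positivity : 0 < 16 * c / p)]
      exact_mod_cast this
    have hcard : (n : ℝ) / 8 ≤ (n / 2 - n / 4 : ℕ) := by
      have : n ≤ 8 * (n / 2 - n / 4) := by omega
      have : (n : ℝ) ≤ 8 * (n / 2 - n / 4 : ℕ) := by exact_mod_cast this
      linarith
    have hsum : ∑ i ∈ Finset.Ioc (n / 4) (n / 2), min (walkDiff a z N i ω ^ 2) 1 ≤ D := by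
      refine (Finset.sum_le_sum fun i _ => min_le_left _ _).trans
        (Finset.sum_le_sum_of_subset_of_nonneg (fun i hi => ?_) fun i _ _ => sq_nonneg _)
      simp at hi ⊢
      omega
    have hD : p * n / 16 ≤ D := by
      rw [Finset.sum_sub_distrib, Finset.sum_const, Nat.card_Ioc, nsmul_eq_mul] at hS3
      have := (abs_lt.1 hS3).1
      nlinarith
    have hD0 : 0 < D := lt_of_lt_of_le (by positivity) hD
    have e : (a * D + (S1 - S2)) / D - a = (S1 - S2) / D := by
      field_simp
      ring
    rw [e, abs_div, abs_of_pos hD0, div_mul_eq_mul_div, div_le_iff₀ hD0]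
    have hS : |S1 - S2| ≤ 2 * (c * √n) := (abs_sub _ _).trans (by linarith)
    calc |S1 - S2| * √n ≤ 2 * (c * √n) * √n := by gcongr
      _ = 2 * c * n := by rw [mul_assoc, mul_assoc, hsq]; ring
      _ = (32 * c / p) * (p * n / 16) := by field_simp; ring
      _ ≤ (48 * c / p + 2) * D := by
          gcongr
          have e1 : 32 * c / p = 32 * (c / p) := by ring
          have e2 : 48 * c / p = 48 * (c / p) := by ring
          rw [e1, e2]
          linarith

variable [MeasurableSpace Ω] {P : Measure Ω}

/-- The noise of a dataset may be taken to be measurable, at the cost of a null set. -/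
lemma IsDataset.exists_gaussianNoise {σ γ lam : ℝ} {m n Tmin : ℕ}
    {x : ℕ → ℕ → Ω → ℝ} (h : IsDataset P σ γ lam m n Tmin x) :
    ∃ z, GaussianNoise P (lam ^ 2 * σ ^ 2 * (1 - γ ^ (2 * m)) / (1 - γ ^ 2)).toNNReal n Tmin z ∧
      (∀ i ∈ Finset.Icc 1 n, ∀ ω, x i 1 ω = 0) ∧
      ∀ᵐ ω ∂P, ∀ i ∈ Finset.Icc 1 n, ∀ j ∈ Finset.Icc 1 Tmin,
        x i (j + 1) ω = γ ^ m * x i j ω + lam * γ ^ m + z i j ω := by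
  obtain ⟨z, hlaw, hind, h1, hx⟩ := h
  have hz : ∀ i j, ∃ f : Ω → ℝ, Measurable f ∧
      (i ∈ Finset.Icc 1 n → j ∈ Finset.Icc 1 Tmin → z i j =ᵐ[P] f) := by
    intro i j
    by_cases hij : i ∈ Finset.Icc 1 n ∧ j ∈ Finset.Icc 1 Tmin
    · have hm := (hlaw i hij.1 j hij.2).aemeasurable
      exact ⟨hm.mk _, hm.measurable_mk, fun _ _ => hm.ae_eq_mk⟩
    · exact ⟨fun _ => 0, measurable_const, fun hi hj => absurd ⟨hi, hj⟩ hij⟩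
  choose z' hz'm hz' using hz
  refine ⟨z', ⟨hz'm, fun i hi j hj => ?_, ?_⟩, h1, ?_⟩
  · rw [← Measure.map_congr (hz' i j hi hj), (hlaw i hi j hj).map_eq]
  · refine hind.congr fun p => hz' _ _ ?_ ?_
    · exact (Finset.mem_product.1 p.2).1
    · exact (Finset.mem_product.1 p.2).2
  · simp only [Filter.eventually_all_finset]
    intro i hi j hj
    filter_upwards [hz' i j hi hj] with ω hω
    rw [hx i hi j hj ω, hω]

/-- With probability at least `1 - δ`, the estimates are within `C / √n` of the true values as soon
as the least squares estimate lies in `(0, 1)`, which then forces the arm to be noisy. -/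
theorem exists_estimation_error_le (γ lam σ : ℝ) (hγ0 : 0 ≤ γ) (hγ1 : γ < 1) (hlam : 0 ≤ lam)
    (hσ : 0 < σ) (m : ℕ) (hm : 1 ≤ m) (Tmin : ℕ) (hT : 1 < Tmin) (δ : ℝ) (hδ : 0 < δ) :
    ∃ C : ℝ, 0 < C ∧ ∀ n : ℕ, 1 ≤ n → ∀ (Ω : Type*) [MeasurableSpace Ω] (P : Measure Ω)
      [IsProbabilityMeasure P] (x : ℕ → ℕ → Ω → ℝ), IsDataset P σ γ lam m n Tmin x →
      ∃ E : Set Ω, MeasurableSet E ∧ P Eᶜ ≤ ENNReal.ofReal δ ∧ ∀ ω ∈ E,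
        aHat n Tmin (fun i j => x i j ω) ∈ Set.Ioo 0 1 →
        0 < lam ∧ |aHat n Tmin (fun i j => x i j ω) - γ ^ m| ≤ C / √n ∧
          |dHat n (fun i j => x i j ω) - lam * γ ^ m| ≤ C / √n := by
  obtain ⟨N, rfl⟩ := Nat.exists_eq_add_of_le' hT.le
  have hN : 1 ≤ N := by omega
  have ha0 : 0 ≤ γ ^ m := by positivity
  have ha1 : γ ^ m ≤ 1 := pow_le_one₀ hγ0 hγ1.le
  set v : NNReal := (lam ^ 2 * σ ^ 2 * (1 - γ ^ (2 * m)) / (1 - γ ^ 2)).toNNReal with hv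
  rcases hlam.eq_or_lt with hlam0 | hlam0
  · -- Without exposure the data is almost surely constant, and the estimate is `0 / 0 = 0`.
    have hv0 : v = 0 := by rw [hv, ← hlam0]; simp
    refine ⟨1, one_pos, fun n hn Ω _ P _ x hdata => ?_⟩
    obtain ⟨z, hz, h1, hx⟩ := hdata.exists_gaussianNoise
    rw [← hv, hv0] at hz
    have hz0 : ∀ᵐ ω ∂P, ∀ i ∈ Finset.Icc 1 n, ∀ j ∈ Finset.Icc 1 (N + 1), z i j ω = 0 := by
      simp only [Filter.eventually_all_finset]
      intro i hi j hj
      refine ae_of_ae_map (p := fun y : ℝ => y = 0) (hz.measurable i j).aemeasurable ?_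
      rw [hz.law i hi j hj, gaussianReal_zero_var, ae_dirac_eq]
      rfl
    have hnull : P {ω | ¬ ((∀ i ∈ Finset.Icc 1 n, ∀ j ∈ Finset.Icc 1 (N + 1),
        x i (j + 1) ω = γ ^ m * x i j ω + lam * γ ^ m + z i j ω) ∧
        ∀ i ∈ Finset.Icc 1 n, ∀ j ∈ Finset.Icc 1 (N + 1), z i j ω = 0)} = 0 :=
      ae_iff.1 (hx.and hz0)
    set F := {ω | ¬ ((∀ i ∈ Finset.Icc 1 n, ∀ j ∈ Finset.Icc 1 (N + 1),
        x i (j + 1) ω = γ ^ m * x i j ω + lam * γ ^ m + z i j ω) ∧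
        ∀ i ∈ Finset.Icc 1 n, ∀ j ∈ Finset.Icc 1 (N + 1), z i j ω = 0)}
    refine ⟨(toMeasurable P F)ᶜ, (measurableSet_toMeasurable P _).compl, ?_, fun ω hω hI => ?_⟩
    · rw [compl_compl, measure_toMeasurable, hnull]
      exact zero_le
    · have hω' := not_not.1 fun h => hω (subset_toMeasurable P _ h)
      have hD : ∑ i ∈ Finset.Icc 1 (n / 2), walkDiff (γ ^ m) z N i ω ^ 2 = 0 := by
        refine Finset.sum_eq_zero fun i hi => ?_
        rw [walkDiff, walk_eq_zero N fun j hj => hω'.2 i (by simp at hi ⊢; omega) j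
          (by simp at hj ⊢; omega), walk_eq_zero N fun j hj => hω'.2 (2 * i)
          (by simp at hi ⊢; omega) j (by simp at hj ⊢; omega)]
        simp
      rw [aHat_eq (fun i hi => h1 i hi ω) hω'.1, hD, div_zero] at hI
      exact absurd hI.1 (lt_irrefl _)
  · have hv0 : 0 < v := by
      have h2m : γ ^ (2 * m) < 1 := pow_lt_one₀ hγ0 hγ1 (by omega)
      have h2 : γ ^ 2 < 1 := pow_lt_one₀ hγ0 hγ1 two_ne_zero
      rw [hv, Real.toNNReal_pos]
      exact div_pos (mul_pos (by positivity) (by linarith)) (by linarith)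
    set w := walkVar (γ ^ m) v N + walkVar (γ ^ m) v N with hw
    have hp := truncMean_pos (w := w) (add_pos (walkVar_pos hv0 hN) (walkVar_pos hv0 hN))
    set p := truncMean w
    set B : ℝ := w * v + v + 1 with hB
    have hB0 : 0 < B := by positivity
    -- `c` is chosen such that each of the four Chebyshev bounds contributes at most `δ / 4`.
    set c := √(4 * B / δ) with hc
    have hc0 : 0 < c := Real.sqrt_pos.2 (by positivity)
    have hc2 : c ^ 2 = 4 * B / δ := Real.sq_sqrt (by positivity)
    have hle : ∀ b : ℝ, b ≤ B → ENNReal.ofReal (b / c ^ 2) ≤ ENNReal.ofReal (δ / 4) := by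
      intro b hb
      apply ENNReal.ofReal_le_ofReal
      rw [div_le_iff₀ (by positivity), hc2]
      field_simp
      linarith
    refine ⟨48 * c / p + 2 + c, by positivity, fun n hn Ω _ P _ x hdata => ?_⟩
    obtain ⟨z, hz, h1, hx⟩ := hdata.exists_gaussianNoise
    rw [← hv] at hz
    have hn0 : (0 : ℝ) < n := by exact_mod_cast hn
    have hsn : 0 < √(n : ℝ) := Real.sqrt_pos.2 hn0
    have hwv : (0 : ℝ) ≤ w * v := by positivity
    have hvv : (0 : ℝ) ≤ v := v.2
    have hF1 := (hz.measure_sum_walkDiff_mul_le (a := γ ^ m) hn (φ := fun i => i)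
      Function.injective_id (fun i hi => by simp at hi ⊢; omega) hc0).trans
      (hle _ (by rw [hB]; linarith))
    have hF2 := (hz.measure_sum_walkDiff_mul_le (a := γ ^ m) hn (φ := fun i => 2 * i)
      (fun i j hij => by simpa using hij) (fun i hi => by simp at hi ⊢; omega) hc0).trans
      (hle _ (by rw [hB]; linarith))
    have hF3 := (hz.measure_sum_trunc_le (a := γ ^ m) hn hc0).trans
      (hle 1 (by rw [hB]; linarith))
    have hF4 := (hz.measure_sum_le hn hc0).trans (hle _ (by rw [hB]; linarith))
    have hnull := ae_iff.1 hx
    set F1 := {ω | c * √n ≤ |∑ i ∈ Finset.Icc 1 (n / 2),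
      walkDiff (γ ^ m) z N i ω * z i (N + 1) ω|} with hF1def
    set F2 := {ω | c * √n ≤ |∑ i ∈ Finset.Icc 1 (n / 2),
      walkDiff (γ ^ m) z N i ω * z (2 * i) (N + 1) ω|} with hF2def
    set F3 := {ω | c * √n ≤ |∑ i ∈ Finset.Ioc (n / 4) (n / 2),
      (min (walkDiff (γ ^ m) z N i ω ^ 2) 1 - p)|} with hF3def
    set F4 := {ω | c * √n ≤ |∑ i ∈ Finset.Icc 1 n, z i 1 ω|} with hF4def
    set F0 := {ω | ¬ ∀ i ∈ Finset.Icc 1 n, ∀ j ∈ Finset.Icc 1 (N + 1),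
      x i (j + 1) ω = γ ^ m * x i j ω + lam * γ ^ m + z i j ω} with hF0def
    refine ⟨(toMeasurable P (F0 ∪ F1 ∪ F2 ∪ F3 ∪ F4))ᶜ, (measurableSet_toMeasurable P _).compl,
      ?_, fun ω hω hI => ?_⟩
    · rw [compl_compl, measure_toMeasurable]
      calc P (F0 ∪ F1 ∪ F2 ∪ F3 ∪ F4) ≤ P F0 + P F1 + P F2 + P F3 + P F4 := by
            refine (measure_union_le _ _).trans (add_le_add_left ?_ _)
            refine (measure_union_le _ _).trans (add_le_add_left ?_ _)
            refine (measure_union_le _ _).trans (add_le_add_left ?_ _)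
            exact measure_union_le _ _
        _ ≤ 0 + ENNReal.ofReal (δ / 4) + ENNReal.ofReal (δ / 4) + ENNReal.ofReal (δ / 4) +
            ENNReal.ofReal (δ / 4) := by gcongr; exact hnull.le
        _ = ENNReal.ofReal δ := by
            rw [zero_add, ← ENNReal.ofReal_add, ← ENNReal.ofReal_add, ← ENNReal.ofReal_add]
            · congr 1; ring
            all_goals positivity
    · have hω' : ω ∉ F0 ∪ F1 ∪ F2 ∪ F3 ∪ F4 := fun h => hω (subset_toMeasurable P _ h)
      simp only [Set.mem_union, not_or] at hω'
      obtain ⟨⟨⟨⟨h0, hS1⟩, hS2⟩, hS3⟩, hS4⟩ := hω'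
      rw [hF0def, Set.mem_ofPred_eq, not_not] at h0
      have h1' := fun i hi => h1 i hi ω
      refine ⟨hlam0, ?_, ?_⟩
      · refine (abs_aHat_sub_le hn ha0 ha1 hp hc0 h1' h0 (not_le.1 hS1) (not_le.1 hS2)
          (not_le.1 hS3) hI).trans ?_
        exact div_le_div_of_nonneg_right (by linarith) hsn.le
      · rw [dHat_sub_eq hn h1' h0, abs_div, abs_of_pos hn0, div_le_div_iff₀ hn0 hsn]
        have hS4' : |∑ i ∈ Finset.Icc 1 n, z i 1 ω| < c * √n := not_le.1 hS4
        have hsq : √(n : ℝ) * √n = n := Real.mul_self_sqrt hn0.le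
        calc |∑ i ∈ Finset.Icc 1 n, z i 1 ω| * √n ≤ c * √n * √n := by gcongr
          _ = c * n := by rw [mul_assoc, hsq]
          _ ≤ _ := by
              gcongr
              have : 0 < 48 * c / p := by positivity
              linarith

end Estimation

/-- Stability of `m`-th roots away from `0`. -/
lemma abs_sub_mul_le_abs_pow_sub {u y : ℝ} {m : ℕ} (hm : 1 ≤ m) (hu0 : 0 ≤ u) (hu1 : u ≤ 1)
    (hy : 0 ≤ y) : |u - y| * u ^ m ≤ |u ^ m - y ^ m| := by
  rw [← geom_sum₂_mul u y m, abs_mul, mul_comm]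
  gcongr
  have h0 : ∀ i ∈ Finset.range m, 0 ≤ u ^ i * y ^ (m - 1 - i) := fun i _ => by positivity
  rw [abs_of_nonneg (Finset.sum_nonneg h0)]
  calc u ^ m ≤ u ^ (m - 1) := pow_le_pow_of_le_one hu0 hu1 (by omega)
    _ = u ^ (m - 1) * y ^ (m - 1 - (m - 1)) := by simp
    _ ≤ _ := Finset.single_le_sum h0 (Finset.mem_range.2 (by omega))

/-- Errors of the estimated parameters of one arm in terms of the errors of `aHat` and `dHat`. The
lower bound on `aHat` makes this hold for `γ = 0` too. -/
lemma estimate_error_le {γ lam a d aLo aHi η : ℝ} {m : ℕ} (hm : 1 ≤ m) (hγ0 : 0 ≤ γ)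
    (hlam : 0 ≤ lam) (haLo : 0 < aLo) (haHi : aHi < 1) (ha : a ∈ Set.Ioo aLo aHi)
    (hea : |a - γ ^ m| ≤ η) (hed : |d - lam * γ ^ m| ≤ η) :
    (0 ≤ |a| ^ (1 / (m : ℝ)) ∧ |a| ^ (1 / (m : ℝ)) ≤ aHi ^ (1 / (m : ℝ))) ∧
      |(|a| ^ (1 / (m : ℝ))) - γ| ≤ η / aLo ∧ |(|d / a|) - lam| ≤ η * (1 + lam) / aLo := by
  have ha0 : 0 < a := haLo.trans ha.1
  have hm0 : (0 : ℝ) < 1 / m := by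
    have : (0 : ℝ) < m := by exact_mod_cast hm
    positivity
  rw [abs_of_pos ha0]
  have hu : (a ^ (1 / (m : ℝ))) ^ m = a := by
    rw [one_div]
    exact Real.rpow_inv_natCast_pow ha0.le (by omega)
  have hu0 : 0 ≤ a ^ (1 / (m : ℝ)) := by positivity
  have hu1 : a ^ (1 / (m : ℝ)) ≤ 1 := Real.rpow_le_one ha0.le (by linarith [ha.2]) hm0.le
  refine ⟨⟨hu0, Real.rpow_le_rpow ha0.le ha.2.le hm0.le⟩, ?_, ?_⟩
  · have h := abs_sub_mul_le_abs_pow_sub hm hu0 hu1 hγ0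
    rw [hu] at h
    rw [le_div_iff₀ haLo]
    calc _ ≤ |a ^ (1 / (m : ℝ)) - γ| * a := by
          gcongr
          exact ha.1.le
      _ ≤ _ := h.trans hea
  · have hγm : 0 ≤ γ ^ m := by positivity
    have e : (|d / a| - lam) * a = (|d| - lam * γ ^ m) + lam * (γ ^ m - a) := by
      rw [abs_div, abs_of_pos ha0]
      field_simp
      ring
    have h1 : |(|d| - lam * γ ^ m)| ≤ η := by
      have := abs_abs_sub_abs_le d (lam * γ ^ m)
      rw [abs_of_nonneg (mul_nonneg hlam hγm)] at this
      exact this.trans hed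
    rw [le_div_iff₀ haLo]
    calc _ ≤ |(|d / a|) - lam| * a := by
          gcongr
          exact ha.1.le
      _ = |(|d / a| - lam) * a| := by rw [abs_mul, abs_of_pos ha0]
      _ ≤ |(|d| - lam * γ ^ m)| + |lam * (γ ^ m - a)| := by rw [e]; exact abs_add_le _ _
      _ ≤ η + lam * η := by
          rw [abs_mul, abs_of_nonneg hlam, abs_sub_comm (γ ^ m)]
          gcongr
      _ = _ := by ring

/-- Simultaneous confidence for all arms. -/
lemma exists_estimation_error_le_forall {K : ℕ} (hK : 1 ≤ K) (M : Params K)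
    (hγ : ∀ k, 0 ≤ M.γ k ∧ M.γ k < 1) (hlam : ∀ k, 0 ≤ M.lam k) (σ : ℝ) (hσ : 0 < σ) (m : ℕ)
    (hm : 1 ≤ m) (Tmin : ℕ) (hT : 1 < Tmin) (δ : ℝ) (hδ : 0 < δ) :
    ∃ C : ℝ, 0 < C ∧ ∀ n : ℕ, 1 ≤ n → ∀ (Ω : Type*) [MeasurableSpace Ω] (P : Measure Ω)
      [IsProbabilityMeasure P] (x : Fin K → ℕ → ℕ → Ω → ℝ),
      (∀ k, IsDataset P σ (M.γ k) (M.lam k) m n Tmin (x k)) →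
      ∃ E : Set Ω, MeasurableSet E ∧ ENNReal.ofReal (1 - δ) ≤ P E ∧ ∀ ω ∈ E, ∀ k,
        aHat n Tmin (fun i j => x k i j ω) ∈ Set.Ioo 0 1 →
        0 < M.lam k ∧ |aHat n Tmin (fun i j => x k i j ω) - M.γ k ^ m| ≤ C / √n ∧
          |dHat n (fun i j => x k i j ω) - M.lam k * M.γ k ^ m| ≤ C / √n := by
  have hK0 : (0 : ℝ) < K := by exact_mod_cast hK
  choose C hC hE using fun k => exists_estimation_error_le (M.γ k) (M.lam k) σ (hγ k).1 (hγ k).2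
    (hlam k) hσ m hm Tmin hT (δ / K) (by positivity)
  have hCle : ∀ k, C k ≤ ∑ k, C k := fun k =>
    Finset.single_le_sum (fun k _ => (hC k).le) (Finset.mem_univ k)
  refine ⟨∑ k, C k, (hC ⟨0, hK⟩).trans_le (hCle _), fun n hn Ω _ P _ x hx => ?_⟩
  choose E hEm hEP hEω using fun k => hE k n hn Ω P (x k) (hx k)
  refine ⟨⋂ k, E k, MeasurableSet.iInter hEm, ?_, fun ω hω k hI => ?_⟩
  · have h1 : P (⋂ k, E k)ᶜ ≤ ENNReal.ofReal δ := by
      rw [Set.compl_iInter]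
      calc P (⋃ k, (E k)ᶜ) ≤ ∑ k, P (E k)ᶜ := measure_iUnion_fintype_le _ _
        _ ≤ ∑ _k : Fin K, ENNReal.ofReal (δ / K) := Finset.sum_le_sum fun k _ => hEP k
        _ = ENNReal.ofReal δ := by
            rw [Finset.sum_const, Finset.card_univ, Fintype.card_fin, ← ENNReal.ofReal_nsmul]
            congr 1
            rw [nsmul_eq_mul]
            field_simp
    have h2 := prob_compl_eq_one_sub (μ := P) (MeasurableSet.iInter hEm).compl
    rw [compl_compl] at h2
    rw [h2, ENNReal.ofReal_sub _ hδ.le, ENNReal.ofReal_one]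
    exact tsub_le_tsub_left h1 1
  · obtain ⟨h1, h2, h3⟩ := hEω k ω (Set.mem_iInter.1 hω k) hI
    have h4 : C k / √n ≤ (∑ k, C k) / √n := div_le_div_of_nonneg_right (hCle k) (by positivity)
    exact ⟨h1, h2.trans h4, h3.trans h4⟩

end ReboundingBandit

end

theorem mainTheorem8 (K : ℕ) (hK : 1 ≤ K) (M : ReboundingBandit.Params K)
    (hγ : ∀ k, 0 ≤ M.γ k ∧ M.γ k < 1) (hlam : ∀ k, 0 ≤ M.lam k)
    (σ : ℝ) (hσ : 0 < σ) (m : ℕ) (hm : 1 ≤ m) (Tmin : ℕ) (hTmin : 1 < Tmin)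
    (aLo aHi : ℝ) (haLo : 0 < aLo) (haLoHi : aLo < aHi) (haHi : aHi < 1)
    (δ : ℝ) (hδ0 : 0 < δ) (hδ1 : δ < 1) :
    ∃ C : ℝ, 0 < C ∧
      ∀ T n : ℕ, 1 ≤ T → 64 * Real.log (2 / δ) ≤ (n : ℝ) →
      ∀ (Ω : Type*) [MeasurableSpace Ω] (P : Measure Ω) [IsProbabilityMeasure P]
        (x : Fin K → ℕ → ℕ → Ω → ℝ),
        (∀ k, ReboundingBandit.IsDataset P σ (M.γ k) (M.lam k) m n Tmin (x k)) →
        ∃ E : Set Ω, MeasurableSet E ∧ ENNReal.ofReal (1 - δ) ≤ P E ∧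
          ∀ ω ∈ E,
            (∀ k, ReboundingBandit.aHat n Tmin (fun i j => x k i j ω) ∈ Set.Ioo aLo aHi) →
            (∃ π, ReboundingBandit.IsOptimal σ M T π) ∧
            (∃ π, ReboundingBandit.IsOptimal σ
              (ReboundingBandit.estimate M m n Tmin (fun k i j => x k i j ω)) T π) ∧
            ∀ πstar πhat : ReboundingBandit.Policy K,
              ReboundingBandit.IsOptimal σ M T πstar →
              ReboundingBandit.IsOptimal σ
                (ReboundingBandit.estimate M m n Tmin (fun k i j => x k i j ω)) T πhat →
              |ReboundingBandit.value σ M T πstar 1 (ReboundingBandit.initState K)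
                - ReboundingBandit.value σ M T πhat 1 (ReboundingBandit.initState K)|
                ≤ C * (T : ℝ) ^ 2 / Real.sqrt n := by
  have : Nonempty (Fin K) := ⟨⟨0, hK⟩⟩
  obtain ⟨C, hC, hest⟩ := ReboundingBandit.exists_estimation_error_le_forall hK M hγ hlam σ hσ
    m hm Tmin hTmin δ hδ0
  have hm0 : (0 : ℝ) < 1 / m := by
    have : (0 : ℝ) < m := by exact_mod_cast hm
    positivity
  -- uniform bounds for the true and the estimated parameters
  obtain ⟨kγ, hkγ⟩ := Finite.exists_max M.γ
  obtain ⟨kl, hkl⟩ := Finite.exists_max M.lam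
  obtain ⟨kb, hkb⟩ := Finite.exists_max fun k => |M.b k|
  obtain ⟨k₀, hk₀⟩ := Finite.exists_min M.lam
  set ρ := max (M.γ kγ) (aHi ^ (1 / (m : ℝ))) with hρdef
  have hρ : ρ < 1 :=
    max_lt (hγ kγ).2 (Real.rpow_lt_one (by linarith) haHi hm0)
  set Cε := C * (1 + M.lam kl) / aLo with hCεdef
  have hlkl := hlam kl
  have hCε : 0 < Cε := by positivity
  set Λ := M.lam kl + Cε with hΛdef
  have hΛ : 0 ≤ Λ := by positivity
  -- If `lam k₀ = 0`, the estimates of the arm `k₀` almost surely do not meet the hypothesis.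
  set ℓ := if 0 < M.lam k₀ then M.lam k₀ else 1 with hℓdef
  have hℓ : 0 < ℓ := by
    rw [hℓdef]
    split_ifs with h
    · exact h
    · exact one_pos
  obtain ⟨κ, hκ, hval⟩ := ReboundingBandit.exists_abs_value_sub_value_le σ ρ Λ |M.b kb| ℓ
    hσ hρ hΛ (abs_nonneg _) hℓ
  refine ⟨κ * Cε, by positivity, fun T n _ hn Ω _ P _ x hx => ?_⟩
  have hn1 : 1 ≤ n := by
    have hlog : 0 < Real.log (2 / δ) := Real.log_pos (by rw [lt_div_iff₀ hδ0]; linarith)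
    have : (0 : ℝ) < n := by linarith
    exact_mod_cast this
  have hsn : 1 ≤ √(n : ℝ) := Real.one_le_sqrt.2 (by exact_mod_cast hn1)
  obtain ⟨E, hEm, hEP, hE⟩ := hest n hn1 Ω P x hx
  refine ⟨E, hEm, hEP, fun ω hω hI => ?_⟩
  have herr := fun k => hE ω hω k ⟨haLo.trans (hI k).1, (hI k).2.trans haHi⟩
  have hest' := fun k => ReboundingBandit.estimate_error_le hm (hγ k).1 (hlam k) haLo haHi (hI k)
    (herr k).2.1 (herr k).2.2
  set M' := ReboundingBandit.estimate M m n Tmin (fun k i j => x k i j ω) with hM'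
  have hγerr : ∀ k, |M'.γ k - M.γ k| ≤ Cε / √n := fun k => by
    refine (hest' k).2.1.trans ?_
    rw [hCεdef, div_div, div_div, mul_comm aLo]
    exact div_le_div_of_nonneg_right (by nlinarith) (by positivity)
  have hlerr : ∀ k, |M'.lam k - M.lam k| ≤ Cε / √n := fun k => by
    refine (hest' k).2.2.trans ?_
    have : C / √n * (1 + M.lam k) / aLo = C * (1 + M.lam k) / aLo / √n := by ring
    rw [this, hCεdef]
    have := hkl k
    gcongr
  have hclose : M.Close M' ρ Λ |M.b kb| (Cε / √n) :=
    { left :=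
        { γ_nonneg := fun k => (hγ k).1
          γ_le := fun k => (hkγ k).trans (le_max_left _ _)
          lam_nonneg := hlam
          lam_le := fun k => (hkl k).trans (by linarith)
          abs_b_le := hkb }
      right :=
        { γ_nonneg := fun k => (hest' k).1.1
          γ_le := fun k => (hest' k).1.2.trans (le_max_right _ _)
          lam_nonneg := fun k => abs_nonneg _
          lam_le := fun k => by
            have h1 := (abs_le.1 (hlerr k)).2
            have h2 : Cε / √n ≤ Cε := div_le_self hCε.le hsn
            have h3 := hkl k
            linarith
          abs_b_le := hkb }
      γ := hγerr
      lam := hlerr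
      b := fun _ => rfl }
  refine ⟨ReboundingBandit.exists_isOptimal hK hclose.left hσ hρ hΛ T,
    ReboundingBandit.exists_isOptimal hK hclose.right hσ hρ hΛ T,
    fun πstar πhat hstar hhat => ?_⟩
  have hℓle : ∀ k, ℓ ≤ M.lam k := fun k => by
    rw [hℓdef, if_pos (herr k₀).1]
    exact hk₀ k
  refine (hval K M M' _ hclose hℓle T πstar πhat hstar hhat).trans (le_of_eq ?_)
  ring
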